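/- Let $X$ be an irreducible quasi-projective variety over $\mathbb{C}$, let $k\ge 0$, let $\mathcal{L}_1,\dots,\mathcal{L}_k$ be line bundles on $X$, and let $E_i\subset H^0(X,\mathcal{L}_i)$ ($i=1,\dots,k$) be finite-dimensional base-point-free linear series, i.e. complex linear subspaces such that for every $x\in X$ some $s\in E_i$ has $s(x)\neq 0$. Put $\mathbf{E}=E_1\times\cdots\times E_k$, regarded as an affine space, and let the consistency variety $R_{\mathbf{E}}\subset\mathbf{E}$ be the Zariski closure of the set of all $(s_1,\dots,s_k)\in\mathbf{E}$ for which there is a point $x\in X$ with $s_1(x)=\cdots=s_k(x)=0$. For $J\subset\{1,\dots,k\}$ let $E_J\subset H^0\bigl(X,\bigotimes_{j\in J}\mathcal{L}_j\bigr)$ be the linear span of all products $\bigotimes_{j\in J}s_j$ with $s_j\in E_j$ (for $J=\varnothing$ this is the space of constants in $H^0(X,\mathcal{O}_X)$). Let $\Phi_J:X\to\mathbb{P}(E_J^*)$ be its Kodaira map, which sends $x$ to the hyperplane $\{g\in E_J: g(x)=0\}$ of $E_J$, that is, to the line in $E_J^*$ spanned by evaluation at $x$. Let $\tau_J=\dim\Phi_J(X)$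 (Krull dimension in the Zariski topology), let $\operatorname{def}(E_J)=\tau_J-|J|$ be the defect of $J$, and let $$d(\mathcal{E})=\min_{J\subset\{1,\dots,k\}}\operatorname{def}(E_J),$$ the minimum being over all subsets $J$, including $J=\varnothing$, whose defect is $0$. Then all the dimensions involved are finite, and the codimension of the consistency variety is $$\operatorname{codim}_{\mathbf{E}}R_{\mathbf{E}}=\dim\mathbf{E}-\dim R_{\mathbf{E}}=-d(\mathcal{E}).$$ -/

import Mathlib

open scoped LinearAlgebra.Projectivization Topology

universe u w

noncomputable section

/-! ### Zariski topologies and dimension (everything is over `ℂ`, on closed points) -/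

/-- The value at `v` of a polynomial in linear forms on `V`. Up to a choice of a basis these are
all polynomial functions on `V`; homogeneous polynomials give homogeneous functions. -/
def polyEval {V : Type*} [AddCommGroup V] [Module ℂ V]
    (p : MvPolynomial (Module.Dual ℂ V) ℂ) (v : V) : ℂ :=
  MvPolynomial.eval (fun φ => φ v) p

/-- The Zariski topology of a finite-dimensional vector space regarded as an affine space:
the sets `{p ≠ 0}`, for `p` a polynomial function, form a basis of open sets. -/
@[reducible]
def affineZariski (V : Type*) [AddCommGroup V] [Module ℂ V] : TopologicalSpace V :=
  TopologicalSpace.generateFrom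
    {D | ∃ p : MvPolynomial (Module.Dual ℂ V) ℂ, D = {v | polyEval p v ≠ 0}}

/-- The Zariski topology of the projective space of lines in `V`:
the sets `{p ≠ 0}`, for `p` a homogeneous polynomial, form a basis of open sets. -/
@[reducible]
def projZariski (V : Type*) [AddCommGroup V] [Module ℂ V] : TopologicalSpace (ℙ ℂ V) :=
  TopologicalSpace.generateFrom
    {D | ∃ (d : ℕ) (p : MvPolynomial (Module.Dual ℂ V) ℂ),
      p.IsHomogeneous d ∧ D = {x | polyEval p x.rep ≠ 0}}

/-- The Krull dimension of a subset `S` of a space with topology `t`. -/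
def krullDimOf {T : Type*} (t : TopologicalSpace T) (S : Set T) : WithBot ℕ∞ :=
  @topologicalKrullDim S (TopologicalSpace.induced (fun x : S => (x : T)) t)

/-- The dimension as a natural number (meaningful when `krullDimOf t S` is finite). -/
def dimOf {T : Type*} (t : TopologicalSpace T) (S : Set T) : ℕ :=
  ((krullDimOf t S).unbotD 0).toNat

/-- The codimension of a subvariety `S` in an ambient variety `T`. -/
def codimOf {T : Type*} (t : TopologicalSpace T) (S : Set T) : ℤ :=
  (dimOf t Set.univ : ℤ) - (dimOf t S : ℤ)

/-! ### Quasi-projective varieties and regular functions -/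

/-- An irreducible quasi-projective variety: an irreducible (in particular non-empty) locally
closed subset of the projective space of `V`. -/
structure QPVariety (V : Type u) [AddCommGroup V] [Module ℂ V] where
  carrier : Set (ℙ ℂ V)
  locallyClosed : @IsLocallyClosed _ (projZariski V) carrier
  irreducible : @IsIrreducible _ (projZariski V) carrier

namespace QPVariety

variable {V : Type u} [AddCommGroup V] [Module ℂ V] (X : QPVariety V)

/-- The type of points of `X`. -/
def Pt : Type u := {x : ℙ ℂ V // x ∈ X.carrier}

/-- The Zariski topology of `X`. -/
@[reducible]
def zariski : TopologicalSpace X.Pt :=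
  TopologicalSpace.induced (fun x : X.Pt => x.1) (projZariski V)

variable {X}

/-- The value at a point of `X` of a polynomial, on the chosen representative of the point. -/
def homEval (p : MvPolynomial (Module.Dual ℂ V) ℂ) (x : X.Pt) : ℂ := polyEval p x.1.rep

/-- `f : U → ℂ` is regular: locally it is a quotient of two homogeneous polynomials of the same
degree (such a quotient does not depend on the representatives of the points). -/
def IsRegular {U : Set X.Pt} (f : U → ℂ) : Prop :=
  ∀ x : U, ∃ W : Set X.Pt, IsOpen[X.zariski] W ∧ x.1 ∈ W ∧
    ∃ (d : ℕ) (p q : MvPolynomial (Module.Dual ℂ V) ℂ), p.IsHomogeneous d ∧ q.IsHomogeneous d ∧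
      ∀ y : U, y.1 ∈ W → homEval q y.1 ≠ 0 ∧ f y = homEval p y.1 / homEval q y.1

theorem IsRegular.zero {U : Set X.Pt} : IsRegular (fun _ : U => (0 : ℂ)) := by
  intro x
  refine ⟨Set.univ, @isOpen_univ _ X.zariski, trivial, 0, 0, 1, MvPolynomial.isHomogeneous_zero _ _ _,
    MvPolynomial.isHomogeneous_one _ _, fun y _ => ?_⟩
  simp [homEval, polyEval]

theorem IsRegular.add {U : Set X.Pt} {f g : U → ℂ} (hf : IsRegular f) (hg : IsRegular g) :
    IsRegular (f + g) := by
  intro x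
  obtain ⟨W, hW, hx, d, p, q, hp, hq, h⟩ := hf x
  obtain ⟨W', hW', hx', d', p', q', hp', hq', h'⟩ := hg x
  refine ⟨W ∩ W', @IsOpen.inter _ X.zariski _ _ hW hW', ⟨hx, hx'⟩, d + d', p * q' + q * p', q * q',
    (hp.mul hq').add (hq.mul hp'), hq.mul hq', fun y hy => ?_⟩
  obtain ⟨h1, h2⟩ := h y hy.1
  obtain ⟨h3, h4⟩ := h' y hy.2
  simp only [homEval, polyEval, map_mul, map_add, Pi.add_apply] at *
  exact ⟨mul_ne_zero h1 h3, by rw [h2, h4, div_add_div _ _ h1 h3]⟩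

theorem IsRegular.smul {U : Set X.Pt} {f : U → ℂ} (c : ℂ) (hf : IsRegular f) :
    IsRegular (c • f) := by
  intro x
  obtain ⟨W, hW, hx, d, p, q, hp, hq, h⟩ := hf x
  refine ⟨W, hW, hx, d, MvPolynomial.C c * p, q, hp.C_mul c, hq, fun y hy => ?_⟩
  obtain ⟨h1, h2⟩ := h y hy
  refine ⟨h1, ?_⟩
  simp only [homEval, polyEval, map_mul, MvPolynomial.eval_C, Pi.smul_apply, smul_eq_mul] at *
  rw [h2, mul_div_assoc]

/-- A finite product of regular functions is regular on any common subset of their domains. -/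
theorem IsRegular.prod {ι : Type*} [Fintype ι] {U : ι → Set X.Pt} {f : ∀ i, U i → ℂ}
    (hf : ∀ i, IsRegular (f i)) {U' : Set X.Pt} (hU : ∀ i, U' ⊆ U i) :
    IsRegular (fun x : U' => ∏ i, f i ⟨x.1, hU i x.2⟩) := by
  intro x
  choose W hW hx d p q hp hq h using fun i => hf i ⟨x.1, hU i x.2⟩
  refine ⟨⋂ i, W i, @isOpen_iInter_of_finite _ _ X.zariski _ _ hW, Set.mem_iInter.2 hx, ∑ i, d i,
    ∏ i, p i, ∏ i, q i, MvPolynomial.IsHomogeneous.prod _ _ _ fun i _ => hp i,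
    MvPolynomial.IsHomogeneous.prod _ _ _ fun i _ => hq i, fun y hy => ?_⟩
  have h' := fun i => h i ⟨y.1, hU i y.2⟩ (Set.mem_iInter.1 hy i)
  simp only [homEval, polyEval, map_prod] at *
  refine ⟨Finset.prod_ne_zero_iff.2 fun i _ => (h' i).1, ?_⟩
  rw [← Finset.prod_div_distrib]
  exact Finset.prod_congr rfl fun i _ => (h' i).2

end QPVariety

/-! ### Line bundles and their sections -/

/-- A line bundle on `X`, given by transition functions: a Zariski open cover `U` and regular
functions `g a b` on `U a ∩ U b` satisfying the cocycle conditions. -/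
structure LineBundle {V : Type u} [AddCommGroup V] [Module ℂ V] (X : QPVariety V) where
  ι : Type w
  U : ι → Set X.Pt
  isOpen : ∀ a, IsOpen[X.zariski] (U a)
  cover : ∀ x, ∃ a, x ∈ U a
  g : ∀ a b, ↥(U a ∩ U b) → ℂ
  regular : ∀ a b, QPVariety.IsRegular (g a b)
  g_self : ∀ a (x : X.Pt) (h : x ∈ U a), g a a ⟨x, h, h⟩ = 1
  g_mul : ∀ a b c (x : X.Pt) (ha : x ∈ U a) (hb : x ∈ U b) (hc : x ∈ U c),
    g a b ⟨x, ha, hb⟩ * g b c ⟨x, hb, hc⟩ = g a c ⟨x, ha, hc⟩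

namespace LineBundle

variable {V : Type u} [AddCommGroup V] [Module ℂ V] {X : QPVariety V}

/-- The space `H⁰(X, L)` of global regular sections: families of regular functions `s a` on `U a`
with `s a = g a b * s b` on `U a ∩ U b`. -/
def H0 (L : LineBundle.{u, w} X) : Submodule ℂ (∀ a, L.U a → ℂ) where
  carrier := {s | (∀ a, QPVariety.IsRegular (s a)) ∧
    ∀ a b (x : X.Pt) (ha : x ∈ L.U a) (hb : x ∈ L.U b),
      s a ⟨x, ha⟩ = L.g a b ⟨x, ha, hb⟩ * s b ⟨x, hb⟩}
  zero_mem' := ⟨fun _ => QPVariety.IsRegular.zero, by intros; simp⟩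
  add_mem' := by
    rintro s t ⟨hs, hs'⟩ ⟨ht, ht'⟩
    refine ⟨fun a => (hs a).add (ht a), fun a b x ha hb => ?_⟩
    simp only [Pi.add_apply]
    rw [hs' a b x ha hb, ht' a b x ha hb, mul_add]
  smul_mem' := by
    rintro c s ⟨hs, hs'⟩
    refine ⟨fun a => (hs a).smul c, fun a b x ha hb => ?_⟩
    simp only [Pi.smul_apply, smul_eq_mul]
    rw [hs' a b x ha hb, mul_left_comm]

/-- The section `s` vanishes at the point `x`. -/
def Vanishes {L : LineBundle.{u, w} X} (s : L.H0) (x : X.Pt) : Prop :=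
  ∀ a (h : x ∈ L.U a), s.1 a ⟨x, h⟩ = 0

/-- Vanishing at a point can be tested in any one chart containing the point. -/
theorem vanishes_iff {L : LineBundle.{u, w} X} (s : L.H0) (x : X.Pt) (a : L.ι) (h : x ∈ L.U a) :
    Vanishes s x ↔ s.1 a ⟨x, h⟩ = 0 := by
  refine ⟨fun hs => hs a h, fun hs b hb => ?_⟩
  rw [s.2.2 b a x hb h, hs, mul_zero]

/-- The tensor product of a finite family of line bundles: on the common refinement of the covers,
the transition functions are multiplied. (The empty tensor product is the trivial bundle.) -/
def tensor {κ : Type} [Fintype κ] (L : κ → LineBundle.{u, w} X) : LineBundle.{u, w} X where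
  ι := ∀ j, (L j).ι
  U a := ⋂ j, (L j).U (a j)
  isOpen a := @isOpen_iInter_of_finite _ _ X.zariski _ _ fun j => (L j).isOpen (a j)
  cover x := ⟨fun j => ((L j).cover x).choose,
    Set.mem_iInter.2 fun j => ((L j).cover x).choose_spec⟩
  g a b x := ∏ j, (L j).g (a j) (b j) ⟨x.1, Set.mem_iInter.1 x.2.1 j, Set.mem_iInter.1 x.2.2 j⟩
  regular a b := QPVariety.IsRegular.prod (fun j => (L j).regular (a j) (b j))
    fun j _ hx => ⟨Set.mem_iInter.1 hx.1 j, Set.mem_iInter.1 hx.2 j⟩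
  g_self a x h := Finset.prod_eq_one fun j _ => (L j).g_self _ _ (Set.mem_iInter.1 h j)
  g_mul a b c x ha hb hc := by
    rw [← Finset.prod_mul_distrib]
    exact Finset.prod_congr rfl fun j _ => (L j).g_mul _ _ _ _ (Set.mem_iInter.1 ha j)
      (Set.mem_iInter.1 hb j) (Set.mem_iInter.1 hc j)

/-- The section `⨂ⱼ sⱼ` of `⨂ⱼ Lⱼ`. -/
def tensorSection {κ : Type} [Fintype κ] {L : κ → LineBundle.{u, w} X} (s : ∀ j, (L j).H0) :
    (tensor L).H0 :=
  ⟨fun a x => ∏ j, (s j).1 (a j) ⟨x.1, Set.mem_iInter.1 x.2 j⟩,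
    fun a => QPVariety.IsRegular.prod (fun j => (s j).2.1 (a j))
      fun j _ hx => Set.mem_iInter.1 hx j,
    fun a b x ha hb => (Finset.prod_congr rfl fun j _ =>
      (s j).2.2 (a j) (b j) x (Set.mem_iInter.1 ha j) (Set.mem_iInter.1 hb j)).trans
        Finset.prod_mul_distrib⟩

/-! ### Linear series, products, Kodaira maps -/

/-- A linear series `E ⊆ H⁰(X, L)` is base-point-free: no point of `X` is a common zero of `E`. -/
def BasePointFree {L : LineBundle.{u, w} X} (E : Submodule ℂ L.H0) : Prop :=
  ∀ x : X.Pt, ∃ s ∈ E, ¬ Vanishes s x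

/-- The product of linear series: the span of all `⨂ⱼ sⱼ` with `sⱼ ∈ Eⱼ`. -/
def seriesProd {κ : Type} [Fintype κ] {L : κ → LineBundle.{u, w} X}
    (E : ∀ j, Submodule ℂ (L j).H0) : Submodule ℂ (tensor L).H0 :=
  Submodule.span ℂ {t | ∃ s : ∀ j, (L j).H0, (∀ j, s j ∈ E j) ∧ t = tensorSection s}

theorem BasePointFree.prod {κ : Type} [Fintype κ] {L : κ → LineBundle.{u, w} X}
    {E : ∀ j, Submodule ℂ (L j).H0} (hE : ∀ j, BasePointFree (E j)) :
    BasePointFree (seriesProd E) := by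
  intro x
  choose s hs hx using fun j => hE j x
  refine ⟨tensorSection s, Submodule.subset_span ⟨s, hs, rfl⟩, ?_⟩
  obtain ⟨a, ha⟩ := (tensor L).cover x
  rw [vanishes_iff _ x a ha]
  refine Finset.prod_ne_zero_iff.2 fun j _ => ?_
  exact fun h => hx j ((vanishes_iff (s j) x (a j) (Set.mem_iInter.1 ha j)).2 h)

/-- The chosen chart around a point. -/
def chart (L : LineBundle.{u, w} X) (x : X.Pt) : L.ι := (L.cover x).choose

theorem mem_chart (L : LineBundle.{u, w} X) (x : X.Pt) : x ∈ L.U (L.chart x) :=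
  (L.cover x).choose_spec

/-- Evaluation at `x` (in the chosen chart) as a linear form on `E`. -/
def evalForm {L : LineBundle.{u, w} X} (E : Submodule ℂ L.H0) (x : X.Pt) : Module.Dual ℂ E where
  toFun s := s.1.1 (L.chart x) ⟨x, L.mem_chart x⟩
  map_add' _ _ := rfl
  map_smul' _ _ := rfl

theorem evalForm_eq_zero_iff {L : LineBundle.{u, w} X} (E : Submodule ℂ L.H0) (x : X.Pt) (s : E) :
    evalForm E x s = 0 ↔ Vanishes s.1 x :=
  (vanishes_iff s.1 x _ _).symm

theorem evalForm_ne_zero {L : LineBundle.{u, w} X} {E : Submodule ℂ L.H0} (hE : BasePointFree E)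
    (x : X.Pt) : evalForm E x ≠ 0 := by
  obtain ⟨s, hs, hx⟩ := hE x
  intro h
  exact hx ((evalForm_eq_zero_iff E x ⟨s, hs⟩).1 (by rw [h]; rfl))

/-- The Kodaira map `Φ_E : X → ℙ(E*)`. The image of `x` is the line of linear forms on `E` whose
kernel is the hyperplane of the sections vanishing at `x`. -/
def kodaira {L : LineBundle.{u, w} X} (E : Submodule ℂ L.H0) (hE : BasePointFree E) (x : X.Pt) :
    ℙ ℂ (Module.Dual ℂ E) :=
  Projectivization.mk ℂ (evalForm E x) (evalForm_ne_zero hE x)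

/-! ### Defects and the consistency variety -/

section Collection

variable {k : ℕ} {L : Fin k → LineBundle.{u, w} X} (E : ∀ i, Submodule ℂ (L i).H0)
  (hE : ∀ i, BasePointFree (E i))

/-- `Y_J`, the image of the Kodaira map of the product series `E_J = ∏_{j ∈ J} E_j`. -/
def kodairaImage (J : Finset (Fin k)) :
    Set (ℙ ℂ (Module.Dual ℂ (seriesProd fun j : J => E j))) :=
  Set.range (kodaira (seriesProd fun j : J => E j) (BasePointFree.prod fun j : J => hE j))

/-- `τ_J`, the dimension of `Y_J`. -/
def tau (J : Finset (Fin k)) : ℕ := dimOf (projZariski _) (kodairaImage E hE J)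

/-- The defect of a subcollection. -/
def defect (J : Finset (Fin k)) : ℤ := (tau E hE J : ℤ) - (J.card : ℤ)

/-- The minimal defect over all subcollections, the empty one included. -/
def minDefect : ℤ :=
  (Finset.univ : Finset (Finset (Fin k))).inf' ⟨∅, Finset.mem_univ _⟩ (defect E hE)

/-- The incidence variety in `X × (E_1 × ⋯ × E_k)`. -/
def incidence : Set (X.Pt × (∀ i, E i)) := {z | ∀ i, Vanishes (z.2 i).1 z.1}

/-- The consistency variety: the Zariski closure in `E_1 × ⋯ × E_k` of the set of all systems which
have a common root. -/
def consistencyVariety : Set (∀ i, E i) :=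
  @closure _ (affineZariski (∀ i, E i)) (Prod.snd '' incidence E)

end Collection

end LineBundle

end

/-! Let N be the dimension of the space of systems. By irreducibility everything can be computed on
one affine open subset U of X whose coordinate ring B is a domain and on which each bundle is
trivialised by a member t_i of a basis of E_i. Dividing the basis sections by t_i gives elements
g_{ij} of B, one of them equal to 1 for every i (`AffineModel`).

Both kinds of dimension become ranks in the matroid of algebraic independence over ℂ. The ratios of
product sections over J and the g_{ij} with i in J have the same algebraic closure in B, so τ_J =
rk{g_{ij} : i ∈ J} (`krullDimOf_kodairaImage`). A system with coefficients u_{ij} vanishes at x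
exactly when ∑_j u_{ij} g_{ij}(x) = 0 for every i, and this can be solved for the coefficient of
t_i. Hence the consistency variety is the closure of the image of U × 𝔸^{N-k}, and its dimension is
the rank, in a polynomial ring over B, of the N - k free variables together with the k elements c_i
= -∑ u_{ij} g_{ij} (`krullDimOf_consistencyVariety`). Passing from ranks to Krull dimensions of sets
of closed points uses Noether normalisation, the Jacobson property and Chevalley's theorem.

It remains to see that this rank is the minimum over J of rk(g_J) + N - |J|. It is at most each of
these numbers: once g_J is adjoined, the c_i with i in J become redundant, and the remaining k - |J|
contribute at most one each (`algRank_genericFamily_le`). For equality, discard c_i's as long as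
each removal lowers the rank by one. In the remaining set J every c_i is algebraic over the free
variables and the other c_j. Translating one variable u_{ij} by 1 preserves that closure and changes
c_i by g_{ij}, so g_J lies in it (`mem_algCl_of_genericComb_mem`), and the rank is large enough
(`exists_le_algRank_genericFamily`). -/

noncomputable section

/-! ### Rank in the matroid of algebraic independence -/

section AlgRank

/-- The algebraic rank over `ℂ` of a subset of a domain: the transcendence degree of the
subalgebra it generates. -/
def algRank {D : Type*} [CommRing D] [IsDomain D] [Algebra ℂ D] (s : Set D) : ℕ∞ :=
  (AlgebraicIndependent.matroid ℂ D).eRk s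

variable {D D' : Type*} [CommRing D] [IsDomain D] [Algebra ℂ D] [CommRing D'] [IsDomain D']
  [Algebra ℂ D']

/-- The relative algebraic closure of the subalgebra generated by `s`. -/
def algCl (s : Set D) : Subalgebra ℂ D :=
  (Subalgebra.algebraicClosure (Algebra.adjoin ℂ s) D).restrictScalars ℂ

theorem mem_algCl {s : Set D} {a : D} : a ∈ algCl s ↔ IsAlgebraic (Algebra.adjoin ℂ s) a :=
  Iff.rfl

/-- One set is both a subalgebra and a matroid closure: the first supplies ring operations, the
second idempotence and rank. -/
theorem coe_algCl (s : Set D) :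
    (algCl s : Set D) = (AlgebraicIndependent.matroid ℂ D).closure s := by
  rw [AlgebraicIndependent.matroid_closure_eq]; rfl

theorem subset_algCl (s : Set D) : s ⊆ algCl s := by
  rw [coe_algCl]
  exact Matroid.subset_closure _ _ (Set.subset_univ _)

theorem algCl_le {s t : Set D} (h : s ⊆ algCl t) : algCl s ≤ algCl t := by
  rw [← SetLike.coe_subset_coe]
  rw [coe_algCl] at h ⊢
  rw [coe_algCl]
  exact Matroid.closure_subset_closure_of_subset_closure h

theorem algCl_mono {s t : Set D} (h : s ⊆ t) : algCl s ≤ algCl t :=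
  algCl_le (h.trans (subset_algCl t))

theorem algRank_mono {s t : Set D} (h : s ⊆ algCl t) : algRank s ≤ algRank t := by
  rw [coe_algCl] at h
  unfold algRank
  rw [← Matroid.eRk_closure_eq _ t]
  exact Matroid.eRk_mono _ h

theorem algRank_congr {s t : Set D} (h : s ⊆ algCl t) (h' : t ⊆ algCl s) :
    algRank s = algRank t :=
  le_antisymm (algRank_mono h) (algRank_mono h')

theorem algRank_of_indep {ι : Type*} {x : ι → D} (hx : AlgebraicIndependent ℂ x) :
    algRank (Set.range x) = ENat.card ι := by
  have h1 : (AlgebraicIndependent.matroid ℂ D).Indep (Set.range x) := hx.to_subtype_range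
  unfold algRank
  rw [h1.eRk_eq_encard, ← Set.image_univ, hx.injective.encard_image]
  simp

theorem exists_indep_subset (s : Set D) : ∃ t ⊆ s, AlgebraicIndependent ℂ ((↑) : t → D) ∧
    t.encard = algRank s ∧ s ⊆ algCl t := by
  obtain ⟨t, ht⟩ := (AlgebraicIndependent.matroid ℂ D).exists_isBasis s
  refine ⟨t, ht.subset, ht.indep, ht.encard_eq_eRk, ?_⟩
  rw [coe_algCl]
  exact ht.subset_closure

/-- Injectivity keeps the coefficients of an algebraic relation from all becoming zero. -/
theorem algHom_mem_algCl (f : D →ₐ[ℂ] D') (hf : Function.Injective f) {s : Set D} {a : D}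
    (ha : a ∈ algCl s) : f a ∈ algCl (f '' s) := by
  rw [mem_algCl] at ha ⊢
  have h : ∀ x : Algebra.adjoin ℂ s, f x ∈ Algebra.adjoin ℂ (f '' s) := fun x => by
    rw [← AlgHom.map_adjoin]; exact ⟨x, x.2, rfl⟩
  let g : Algebra.adjoin ℂ s →ₐ[ℂ] Algebra.adjoin ℂ (f '' s) :=
    (f.comp (Algebra.adjoin ℂ s).val).codRestrict _ h
  have hg : Function.Injective g := fun x y hxy =>
    Subtype.ext (hf (congrArg Subtype.val hxy))
  exact ha.ringHom_of_comp_eq g f.toRingHom hg rfl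

theorem algRank_image (f : D →ₐ[ℂ] D') (hf : Function.Injective f) (s : Set D) :
    algRank (f '' s) = algRank s := by
  obtain ⟨t, hts, hind, hcard, hcl⟩ := exists_indep_subset s
  have h1 : AlgebraicIndependent ℂ (f ∘ ((↑) : t → D)) := hind.map' hf
  have h2 := algRank_of_indep h1
  rw [Set.range_comp, Subtype.range_coe] at h2
  rw [← hcard, ← ENat.card_coe_set_eq, ← h2]
  apply algRank_congr
  · rintro _ ⟨a, ha, rfl⟩
    exact algHom_mem_algCl f hf (hcl ha)
  · exact (Set.image_mono hts).trans (subset_algCl _)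

end AlgRank

/-! ### Krull dimension, transcendence degree and closed points -/

/-- Incomparability makes contraction of primes strictly monotone; lying over and going up lift
chains in the other direction. -/
theorem ringKrullDim_eq_of_integral {R S : Type*} [CommRing R] [CommRing S] [IsDomain S] (f : R →+* S)
    (hf : Function.Injective f) (hi : f.IsIntegral) : ringKrullDim S = ringKrullDim R := by
  algebraize [f]
  have : Algebra.IsIntegral R S := ⟨hi⟩
  apply le_antisymm
  · refine Order.krullDim_le_of_strictMono (PrimeSpectrum.comap f) fun p q h => ?_
    exact Ideal.IsIntegral.comap_lt_comap (R := R) (show p.asIdeal < q.asIdeal from h)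
  · refine iSup_le fun l => ?_
    have hinj : Function.Injective (algebraMap R S) := hf
    obtain ⟨P, hP, hP'⟩ := Ideal.exists_ideal_over_prime_of_isIntegral_of_isDomain
      (S := S) l.head.asIdeal
      (by rw [(RingHom.injective_iff_ker_eq_bot _).1 hinj]; exact bot_le)
    have : P.LiesOver l.head.asIdeal := ⟨hP'.symm⟩
    obtain ⟨L, hL, -⟩ := Ideal.exists_ltSeries_of_hasGoingUp l P
    rw [← hL]
    exact Order.LTSeries.length_le_krullDim L

/-- The Krull dimension of a finitely generated domain is its transcendence degree. -/
theorem ringKrullDim_eq_algRank {A D : Type*} [CommRing A] [Algebra ℂ A] [Algebra.FiniteType ℂ A]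
    [CommRing D] [IsDomain D] [Algebra ℂ D] (j : A →ₐ[ℂ] D) (hj : Function.Injective j) :
    ringKrullDim A = algRank (Set.range j) := by
  have := hj.isDomain j.toRingHom
  obtain ⟨s, h, hinj, hint⟩ := exists_integral_inj_algHom_of_fg ℂ A
  rw [ringKrullDim_eq_of_integral h.toRingHom hinj hint,
    MvPolynomial.ringKrullDim_of_isNoetherianRing, ringKrullDim_eq_zero_of_field]
  have hx : AlgebraicIndependent ℂ (fun i => j (h (MvPolynomial.X i))) :=
    (MvPolynomial.algebraicIndependent_X (Fin s) ℂ).map' (f := j.comp h) (hj.comp hinj)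
  -- `A` is integral over its Noether normalisation, so the normalising variables already span it in
  -- the matroid.
  have h1 : algRank (Set.range j) = algRank (Set.range fun i => j (h (MvPolynomial.X i))) := by
    apply algRank_congr
    · rintro _ ⟨a, rfl⟩
      have h2 : ∀ p, h p ∈ Algebra.adjoin ℂ (Set.range fun i => h (MvPolynomial.X i)) := fun p => by
        rw [← MvPolynomial.aeval_range]
        refine ⟨p, DFunLike.congr_fun (?_ : MvPolynomial.aeval _ = h) p⟩
        ext i
        exact MvPolynomial.aeval_X _ i
      let g : MvPolynomial (Fin s) ℂ →ₐ[ℂ]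
        Algebra.adjoin ℂ (Set.range fun i => h (MvPolynomial.X i)) := h.codRestrict _ h2
      have hg : Function.Injective g := fun x y hxy => hinj (congrArg Subtype.val hxy)
      have h3 : a ∈ algCl (Set.range fun i => h (MvPolynomial.X i)) := by
        algebraize [h.toRingHom]
        have h4 : IsIntegral (MvPolynomial (Fin s) ℂ) a := hint a
        exact h4.isAlgebraic.ringHom_of_comp_eq g (RingHom.id A) hg rfl
      have h5 := algHom_mem_algCl j hj h3
      rwa [← Set.range_comp] at h5
    · rintro _ ⟨i, rfl⟩
      exact subset_algCl _ ⟨_, rfl⟩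
  rw [h1, algRank_of_indep hx]
  simp

/-- Both rings are finitely generated subalgebras of the fraction field with the same algebraic
closure there, hence have equal rank. -/
theorem ringKrullDim_localizationAway {A : Type*} [CommRing A] [IsDomain A] [Algebra ℂ A]
    [Algebra.FiniteType ℂ A] {f : A} (hf : f ≠ 0) :
    ringKrullDim (Localization.Away f) = ringKrullDim A := by
  let K := FractionRing A
  have hinj : Function.Injective (algebraMap A K) := IsFractionRing.injective A K
  have hu : ∀ y : Submonoid.powers f, IsUnit (Algebra.algHom ℂ A K y) := fun y =>
    IsUnit.mk0 _ fun h => by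
      obtain ⟨n, hn⟩ := y.2
      refine pow_ne_zero n hf ?_
      rw [← map_zero (algebraMap A K)] at h
      exact (show f ^ n = y from hn).trans (hinj h)
  let j : Localization.Away f →ₐ[ℂ] K := IsLocalization.liftAlgHom (M := Submonoid.powers f) hu
  have hja : ∀ a, j (algebraMap A _ a) = algebraMap A K a := fun a =>
    IsLocalization.lift_eq (M := Submonoid.powers f) hu a
  have hle : Submonoid.powers f ≤ nonZeroDivisors A := powers_le_nonZeroDivisors_of_noZeroDivisors hf
  have hj : Function.Injective j := by
    refine (IsLocalization.lift_injective_iff hu).2 fun x y => ?_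
    rw [(IsLocalization.injective (Localization.Away f) hle).eq_iff]
    exact hinj.eq_iff.symm
  have : Algebra.FiniteType A (Localization.Away f) :=
    IsLocalization.finiteType_of_monoid_fg (Submonoid.powers f) _
  have : Algebra.FiniteType ℂ (Localization.Away f) := Algebra.FiniteType.trans (S := A) ‹_› ‹_›
  rw [ringKrullDim_eq_algRank j hj, ringKrullDim_eq_algRank (Algebra.algHom ℂ A K) hinj]
  congr 1
  apply algRank_congr
  · rintro _ ⟨x, rfl⟩
    obtain ⟨⟨a, s⟩, h⟩ := IsLocalization.surj (Submonoid.powers f) x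
    have h1 : algebraMap A K s * j x = algebraMap A K a := by
      rw [← hja, ← hja, ← map_mul, ← h, mul_comm]
    refine IsAlgebraic.of_mul (y := algebraMap A K s) ?_ ?_ ?_
    · exact mem_nonZeroDivisors_of_ne_zero (hu s).ne_zero
    · exact subset_algCl _ ⟨_, rfl⟩
    · rw [h1]
      exact subset_algCl _ ⟨_, rfl⟩
  · rintro _ ⟨a, rfl⟩
    exact subset_algCl _ ⟨algebraMap A _ a, hja a⟩

theorem exists_isMaximal_ge_notMem {A : Type*} [CommRing A] [IsJacobsonRing A] (p : Ideal A)
    [hp : p.IsPrime] {a : A} (ha : a ∉ p) : ∃ m : Ideal A, m.IsMaximal ∧ p ≤ m ∧ a ∉ m := by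
  have h := isJacobsonRing_iff_prime_eq.1 ‹_› p hp
  rw [← h, Ideal.jacobson, Ideal.mem_sInf] at ha
  push Not at ha
  obtain ⟨m, ⟨h1, h2⟩, h3⟩ := ha
  exact ⟨m, h2, h1, h3⟩

/-- A subspace of the spectrum of a Jacobson ring containing all closed points of a principal open
subset has at least the dimension of that open subset. -/
theorem ringKrullDim_away_le_topologicalKrullDim {A T : Type*} [CommRing A] [IsJacobsonRing A]
    [TopologicalSpace T] {c : T → PrimeSpectrum A} (hc : Topology.IsInducing c) {f : A}
    (h : ∀ (m : Ideal A) (hm : m.IsMaximal), f ∉ m → ⟨m, hm.isPrime⟩ ∈ Set.range c) :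
    ringKrullDim (Localization.Away f) ≤ topologicalKrullDim T := by
  -- The Jacobson property is applied to `a * f`: the maximal ideal found avoids `f`, so it comes
  -- from a point of `T`.
  have key : ∀ (p : Ideal A) (_ : p.IsPrime), f ∉ p → ∀ a ∉ p, ∃ t, p ≤ (c t).asIdeal ∧
      a ∉ (c t).asIdeal := fun p hp hf a ha => by
    obtain ⟨m, hm, hpm, ham⟩ := exists_isMaximal_ge_notMem p
      (show a * f ∉ p from fun h => (hp.mem_or_mem h).elim ha hf)
    obtain ⟨t, ht⟩ := h m hm fun h => ham (m.mul_mem_left a h)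
    refine ⟨t, ?_, ?_⟩ <;> rw [ht]
    · exact hpm
    · exact fun h => ham (m.mul_mem_right f h)
  have hopen : ∀ u : Set T, IsOpen u → ∀ t ∈ u, ∃ a, a ∉ (c t).asIdeal ∧
      ∀ s, a ∉ (c s).asIdeal → s ∈ u := fun u hu t ht => by
    obtain ⟨u', hu', rfl⟩ := hc.isOpen_iff.1 hu
    obtain ⟨_, ⟨a, rfl⟩, h1, h2⟩ :=
      PrimeSpectrum.isTopologicalBasis_basic_opens.exists_subset_of_mem_open ht hu'
    exact ⟨a, h1, fun s hs => h2 hs⟩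
  have hnot : ∀ q : PrimeSpectrum (Localization.Away f),
      f ∉ (PrimeSpectrum.comap (algebraMap A (Localization.Away f)) q).asIdeal := fun q hq =>
    q.isPrime.ne_top (Ideal.eq_top_of_isUnit_mem _ hq
      (IsLocalization.map_units _ (⟨f, Submonoid.mem_powers f⟩ : Submonoid.powers f)))
  -- A prime avoiding `f` is sent to the trace on `T` of its zero locus. By `key` this trace is
  -- irreducible and remembers the prime, so chains of primes give chains of irreducible closed
  -- sets.
  let Z : PrimeSpectrum (Localization.Away f) → (TopologicalSpace.IrreducibleCloseds T)ᵒᵈ :=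
    fun q => OrderDual.toDual
      { carrier := c ⁻¹' PrimeSpectrum.zeroLocus
          (PrimeSpectrum.comap (algebraMap A (Localization.Away f)) q).asIdeal
        isClosed' := (PrimeSpectrum.isClosed_zeroLocus _).preimage hc.continuous
        isIrreducible' := by
          set p := PrimeSpectrum.comap (algebraMap A (Localization.Away f)) q
          refine ⟨?_, ?_⟩
          · obtain ⟨t, ht, -⟩ := key _ p.isPrime (hnot q) f (hnot q)
            exact ⟨t, ht⟩
          · rintro u v hu hv ⟨s, hs, hsu⟩ ⟨t, ht, htv⟩
            obtain ⟨a, ha, ha'⟩ := hopen u hu s hsu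
            obtain ⟨b, hb, hb'⟩ := hopen v hv t htv
            obtain ⟨r, hr, hab⟩ := key _ p.isPrime (hnot q) (a * b) fun hab =>
              (p.isPrime.mem_or_mem hab).elim (fun h => ha (hs h)) fun h => hb (ht h)
            exact ⟨r, hr, ha' r fun h => hab (Ideal.mul_mem_right _ _ h),
              hb' r fun h => hab (Ideal.mul_mem_left _ _ h)⟩ }
  have hZ : StrictMono Z := fun q q' hqq => by
    have hlt : PrimeSpectrum.comap (algebraMap A (Localization.Away f)) q <
        PrimeSpectrum.comap (algebraMap A (Localization.Away f)) q' := by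
      refine lt_of_le_of_ne (Ideal.comap_mono hqq.le) fun h => hqq.ne ?_
      exact PrimeSpectrum.localization_comap_injective _ (Submonoid.powers f) h
    rw [OrderDual.lt_toDual]
    refine lt_of_le_of_ne (fun t ht => hlt.le.trans ht) fun he => ?_
    obtain ⟨a, ha, ha'⟩ := SetLike.exists_of_lt (show (_ : Ideal A) < _ from hlt)
    obtain ⟨t, ht, hat⟩ := key _ (PrimeSpectrum.isPrime _) (hnot q) a ha'
    have : t ∈ (OrderDual.ofDual (Z q')).carrier := by
      rw [show OrderDual.ofDual (Z q') = _ from he]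
      exact ht
    exact hat (this ha)
  have := Order.krullDim_le_of_strictMono Z hZ
  rwa [Order.krullDim_orderDual] at this

/-! ### Points of affine space and dimension of sets of points -/

section Points

variable {ι : Type*}

/-- The point of the prime spectrum of the polynomial ring defined by a point of affine space. -/
def specPt (z : ι → ℂ) : PrimeSpectrum (MvPolynomial ι ℂ) :=
  ⟨RingHom.ker (MvPolynomial.eval z), RingHom.ker_isPrime _⟩

theorem mem_specPt {z : ι → ℂ} {P : MvPolynomial ι ℂ} :
    P ∈ (specPt z).asIdeal ↔ MvPolynomial.eval z P = 0 := Iff.rfl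

theorem isInducing_specPt {T : Type*} [TopologicalSpace T] {c : T → ι → ℂ}
    (h1 : ∀ P : MvPolynomial ι ℂ, IsOpen {t | MvPolynomial.eval (c t) P ≠ 0})
    (h2 : ∀ O : Set T, IsOpen O → ∀ t ∈ O, ∃ P : MvPolynomial ι ℂ,
      MvPolynomial.eval (c t) P ≠ 0 ∧ ∀ s, MvPolynomial.eval (c s) P ≠ 0 → s ∈ O) :
    Topology.IsInducing fun t => specPt (c t) := by
  refine ⟨le_antisymm ?_ ?_⟩
  · rw [PrimeSpectrum.isTopologicalBasis_basic_opens.eq_generateFrom, induced_generateFrom_eq]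
    refine le_generateFrom ?_
    rintro _ ⟨_, ⟨P, rfl⟩, rfl⟩
    exact h1 P
  · intro O hO
    refine (@isOpen_iff_mem_nhds T (TopologicalSpace.induced _ _) O).2 fun t ht => ?_
    obtain ⟨P, hP, hPO⟩ := h2 O hO t ht
    exact (mem_nhds_induced (fun t => specPt (c t)) t O).2 ⟨PrimeSpectrum.basicOpen P, (PrimeSpectrum.basicOpen P).2.mem_nhds hP,
      fun s hs => hPO s hs⟩

/-- Points satisfying all relations among the `g i` lie in the closed subscheme that is the spectrum
of the algebra generated by `g`. -/
theorem exists_isInducing_range {D : Type*} [CommRing D] [Algebra ℂ D] (g : ι → D)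
    {T : Type*} [TopologicalSpace T] {c : T → ι → ℂ} (hc : Topology.IsInducing fun t => specPt (c t))
    (h : ∀ P : MvPolynomial ι ℂ, MvPolynomial.aeval g P = 0 → ∀ t, MvPolynomial.eval (c t) P = 0) : ∃ c' : T → PrimeSpectrum
    (MvPolynomial.aeval g : MvPolynomial ι ℂ →ₐ[ℂ] D).range, Topology.IsInducing c' ∧
    ∀ t, PrimeSpectrum.comap (MvPolynomial.aeval g : MvPolynomial ι ℂ →ₐ[ℂ] D).rangeRestrict.toRingHom
      (c' t) = specPt (c t) := by
  have hs : Function.Surjective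
      (MvPolynomial.aeval g : MvPolynomial ι ℂ →ₐ[ℂ] D).rangeRestrict.toRingHom :=
    AlgHom.rangeRestrict_surjective _
  have : ∀ t, ∃ q, PrimeSpectrum.comap
      (MvPolynomial.aeval g : MvPolynomial ι ℂ →ₐ[ℂ] D).rangeRestrict.toRingHom q =
        specPt (c t) := fun t => by
    rw [← Set.mem_range, range_comap_of_surjective _ _ hs]
    intro P hP
    exact h P (congrArg Subtype.val hP) t
  choose c' hc' using this
  refine ⟨c', ?_, hc'⟩
  rw [← (PrimeSpectrum.comap_isInducing_of_surjective _ _ hs).of_comp_iff]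
  convert hc using 2
  exact hc' _

variable {D : Type*} [CommRing D] [IsDomain D] [Algebra ℂ D] (g : ι → D)

theorem algRank_range_aeval :
    algRank (Set.range (MvPolynomial.aeval g : MvPolynomial ι ℂ →ₐ[ℂ] D)) =
      algRank (Set.range g) := by
  apply algRank_congr
  · rw [← AlgHom.coe_range, MvPolynomial.aeval_range]
    have : Algebra.adjoin ℂ (Set.range g) ≤ algCl (Set.range g) :=
      Algebra.adjoin_le (subset_algCl _)
    exact this
  · rintro _ ⟨i, rfl⟩
    exact subset_algCl _ ⟨MvPolynomial.X i, MvPolynomial.aeval_X _ _⟩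

theorem ringKrullDim_range_aeval [Finite ι] :
    ringKrullDim (MvPolynomial.aeval g : MvPolynomial ι ℂ →ₐ[ℂ] D).range =
      algRank (Set.range g) := by
  have : Algebra.FiniteType ℂ (MvPolynomial.aeval g : MvPolynomial ι ℂ →ₐ[ℂ] D).range :=
    Algebra.FiniteType.of_surjective _ (AlgHom.rangeRestrict_surjective _)
  rw [ringKrullDim_eq_algRank (Subalgebra.val _) Subtype.val_injective, Subalgebra.coe_val,
    Subtype.range_coe, AlgHom.coe_range, algRank_range_aeval]

variable {T : Type*} [TopologicalSpace T] {c : T → ι → ℂ}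

theorem topologicalKrullDim_le_algRank [Finite ι] (hc : Topology.IsInducing fun t => specPt (c t))
    (h : ∀ P : MvPolynomial ι ℂ, MvPolynomial.aeval g P = 0 → ∀ t, MvPolynomial.eval (c t) P = 0) :
    topologicalKrullDim T ≤ algRank (Set.range g) := by
  obtain ⟨c', hc', -⟩ := exists_isInducing_range g hc h
  refine hc'.topologicalKrullDim_le.trans ?_
  rw [PrimeSpectrum.topologicalKrullDim_eq_ringKrullDim, ringKrullDim_range_aeval]

/-- By the Nullstellensatz the closed points where `F` does not vanish are tuples `z` satisfying the
relations, and all of these come from `T`. Localising at `F` does not lower the dimension. -/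
theorem algRank_le_topologicalKrullDim [Finite ι] (hc : Topology.IsInducing fun t => specPt (c t))
    (h : ∀ P : MvPolynomial ι ℂ, MvPolynomial.aeval g P = 0 → ∀ t, MvPolynomial.eval (c t) P = 0)
    {F : MvPolynomial ι ℂ} (hF : MvPolynomial.aeval g F ≠ 0)
    (hr : ∀ z : ι → ℂ, (∀ P : MvPolynomial ι ℂ, MvPolynomial.aeval g P = 0 →
      MvPolynomial.eval z P = 0) → MvPolynomial.eval z F ≠ 0 → z ∈ Set.range c) :
    algRank (Set.range g) ≤ topologicalKrullDim T := by
  obtain ⟨c', hc', hcc⟩ := exists_isInducing_range g hc h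
  let φ := (MvPolynomial.aeval g : MvPolynomial ι ℂ →ₐ[ℂ] D).rangeRestrict
  have hs : Function.Surjective φ.toRingHom := AlgHom.rangeRestrict_surjective _
  have : Algebra.FiniteType ℂ (MvPolynomial.aeval g : MvPolynomial ι ℂ →ₐ[ℂ] D).range :=
    Algebra.FiniteType.of_surjective _ (AlgHom.rangeRestrict_surjective _)
  have : IsJacobsonRing (MvPolynomial.aeval g : MvPolynomial ι ℂ →ₐ[ℂ] D).range :=
    isJacobsonRing_of_surjective ⟨φ.toRingHom, hs⟩
  have hF' : φ F ≠ 0 := fun h => hF (congrArg Subtype.val h)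
  rw [← ringKrullDim_range_aeval, ← ringKrullDim_localizationAway hF']
  refine ringKrullDim_away_le_topologicalKrullDim hc' fun m hm hFm => ?_
  have hm' : (m.comap φ.toRingHom).IsMaximal := Ideal.comap_isMaximal_of_surjective _ hs
  obtain ⟨z, hz⟩ := MvPolynomial.isMaximal_iff_eq_vanishingIdeal_singleton.1 hm'
  have hz' : ∀ P, P ∈ m.comap φ.toRingHom ↔ MvPolynomial.eval z P = 0 := fun P => by
    rw [hz, MvPolynomial.mem_vanishingIdeal_singleton_iff, MvPolynomial.aeval_eq_eval]
  obtain ⟨t, ht⟩ := hr z (fun P hP => (hz' P).1 (by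
    have : φ P = 0 := Subtype.ext hP
    rw [Ideal.mem_comap]
    exact this ▸ m.zero_mem)) fun h => hFm ((hz' F).2 h)
  refine ⟨t, PrimeSpectrum.comap_injective_of_surjective _ hs ?_⟩
  rw [hcc]
  ext P
  rw [mem_specPt, ht]
  exact (hz' P).symm

end Points

/-- The closure of the image of a dominant morphism of affine varieties has a dense open subset
contained in the image. -/
theorem exists_lift_of_eval_ne_zero {ι : Type*} [Finite ι] {B : Type*} [CommRing B] [IsDomain B]
    [Algebra ℂ B] [Algebra.FiniteType ℂ B] (g : ι → B) :
    ∃ F : MvPolynomial ι ℂ, MvPolynomial.aeval g F ≠ 0 ∧ ∀ z : ι → ℂ,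
      (∀ P : MvPolynomial ι ℂ, MvPolynomial.aeval g P = 0 → MvPolynomial.eval z P = 0) →
      MvPolynomial.eval z F ≠ 0 → ∃ ψ : B →ₐ[ℂ] ℂ, ∀ i, ψ (g i) = z i := by
  let φ := (MvPolynomial.aeval g : MvPolynomial ι ℂ →ₐ[ℂ] B).rangeRestrict
  let A := (MvPolynomial.aeval g : MvPolynomial ι ℂ →ₐ[ℂ] B).range
  have hs : Function.Surjective φ.toRingHom := AlgHom.rangeRestrict_surjective _
  have : Algebra.FiniteType ℂ A := Algebra.FiniteType.of_surjective _ hs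
  have : IsNoetherianRing A := Algebra.FiniteType.isNoetherianRing ℂ A
  have hfin : (algebraMap A B).FinitePresentation :=
    RingHom.FinitePresentation.of_finiteType.1
      (RingHom.finiteType_algebraMap.2 (Algebra.FiniteType.of_restrictScalars_finiteType ℂ A B))
  obtain ⟨S, hS⟩ := PrimeSpectrum.exists_constructibleSetData_iff.2
    (PrimeSpectrum.isConstructible_range_comap hfin)
  -- By Chevalley the image is constructible, and it contains the generic point since `A → B` is
  -- injective. The piece containing that point has all its closed equations zero, so it is the
  -- principal open set of `C.f`.
  have hbot : (⊥ : PrimeSpectrum A) ∈ S.toSet := by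
    rw [hS]
    refine ⟨⊥, PrimeSpectrum.ext ?_⟩
    exact (RingHom.injective_iff_ker_eq_bot _).1 Subtype.val_injective
  obtain ⟨C, hC, h1, h2⟩ := Set.mem_iUnion₂.1 hbot
  have hCS : ∀ q : PrimeSpectrum A, C.f ∉ q.asIdeal →
      q ∈ Set.range (PrimeSpectrum.comap (algebraMap A B)) := fun q hq => by
    rw [← hS]
    refine Set.mem_iUnion₂.2 ⟨C, hC, ?_, ?_⟩
    · exact fun x hx => (bot_le : (⊥ : PrimeSpectrum A) ≤ q) (h1 hx)
    · simpa using hq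
  obtain ⟨F, hF⟩ := hs C.f
  refine ⟨F, fun h => h2 ?_, fun z hz hzF => ?_⟩
  · have : C.f = 0 := hF ▸ Subtype.ext h
    simp [this]
  · have hm : specPt z ∈ Set.range (PrimeSpectrum.comap φ.toRingHom) := by
      rw [range_comap_of_surjective _ _ hs]
      intro P hP
      exact hz P (congrArg Subtype.val hP)
    obtain ⟨m, hm⟩ := hm
    have hm' : ∀ P, φ P ∈ m.asIdeal ↔ MvPolynomial.eval z P = 0 := fun P => by
      rw [← mem_specPt, ← hm]; rfl
    obtain ⟨q, hq⟩ := hCS m (by rw [← hF]; exact fun h => hzF ((hm' F).1 h))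
    -- The prime `q` over `z` need not be closed, but any maximal ideal above it still contains
    -- every `g i - z i` and has residue field ℂ.
    obtain ⟨M, hM, hqM⟩ := Ideal.exists_le_maximal q.asIdeal q.isPrime.ne_top
    let _ := Ideal.Quotient.field M
    have : Algebra.FiniteType ℂ (B ⧸ M) :=
      Algebra.FiniteType.of_surjective (Ideal.Quotient.mkₐ ℂ M) Ideal.Quotient.mk_surjective
    have : Module.Finite ℂ (B ⧸ M) := finite_of_finite_type_of_isJacobsonRing ℂ (B ⧸ M)
    have hbij : Function.Bijective (algebraMap ℂ (B ⧸ M)) :=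
      IsAlgClosed.algebraMap_bijective_of_isIntegral
    let e := AlgEquiv.ofBijective (Algebra.ofId ℂ (B ⧸ M)) hbij
    refine ⟨e.symm.toAlgHom.comp (Ideal.Quotient.mkₐ ℂ M), fun i => ?_⟩
    have h3 : φ (MvPolynomial.X i - MvPolynomial.C (z i)) ∈ m.asIdeal := (hm' _).2 (by simp)
    have h4 : g i - algebraMap ℂ B (z i) ∈ M := hqM (by
      rw [← hq] at h3
      have h5 : ((φ (MvPolynomial.X i - MvPolynomial.C (z i)) : A) : B) ∈ q.asIdeal := h3
      have h6 : ((φ (MvPolynomial.X i - MvPolynomial.C (z i)) : A) : B) =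
          g i - algebraMap ℂ B (z i) := by
        simp [φ]
      rwa [h6] at h5)
    have h5 : Ideal.Quotient.mkₐ ℂ M (g i) = algebraMap ℂ (B ⧸ M) (z i) := by
      exact Ideal.Quotient.eq.2 h4
    rw [AlgHom.comp_apply, h5]
    exact e.symm.commutes (z i)

/-! ### Rank of generic linear combinations -/

section Generic

open MvPolynomial

variable {D : Type*} [CommRing D] [IsDomain D] [Algebra ℂ D]

theorem algRank_union_le (s t : Set D) : algRank (s ∪ t) ≤ algRank s + algRank t :=
  Matroid.eRk_union_le_eRk_add_eRk _ _ _

theorem algRank_le_encard (s : Set D) : algRank s ≤ s.encard :=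
  Matroid.eRk_le_encard _ _

theorem algRank_insert {s : Set D} {a : D} (ha : a ∉ algCl s) :
    algRank (insert a s) = algRank s + 1 := by
  refine Matroid.eRk_insert_eq_add_one ⟨Set.mem_univ _, ?_⟩
  rwa [← coe_algCl]

variable {ι : Type*}

/-- Variables are algebraically independent of elements of the coefficient ring. -/
theorem algRank_X_union_C (t : Set ι) (s : Set D) :
    algRank ((X : ι → MvPolynomial ι D) '' t ∪ C '' s) = t.encard + algRank s := by
  obtain ⟨s', hs, hind, hcard, hcl⟩ := exists_indep_subset s
  have h1 : AlgebraicIndependent D (fun a : t => (X a : MvPolynomial ι D)) :=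
    (algebraicIndependent_X ι D).comp _ Subtype.val_injective
  have h2 := algRank_of_indep (hind.sumElim_comp h1)
  rw [Set.Sum.elim_range, ENat.card_sum, ENat.card_coe_set_eq, ENat.card_coe_set_eq, hcard,
    Set.range_comp, Subtype.range_coe, ← Set.image_eq_range, algebraMap_eq] at h2
  rw [← h2]
  apply algRank_congr
  · rintro _ (h | ⟨a, ha, rfl⟩)
    · exact subset_algCl _ (Or.inl h)
    · refine algCl_mono Set.subset_union_right ?_
      exact algHom_mem_algCl (IsScalarTower.toAlgHom ℂ D (MvPolynomial ι D)) (C_injective ι D)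
        (hcl ha)
  · refine (Set.union_subset_union_right _ (Set.image_mono hs)).trans (subset_algCl _)

variable {k : ℕ} [Fintype ι] (π : ι → Fin k) (p : Fin k → ι) (g : ι → D)

/-- The generic linear combination `-∑ uₐ gₐ` of the members `gₐ`, `π a = i`, of a family, with one
index `p i` left out. -/
def genericComb (i : Fin k) : MvPolynomial ι D :=
  open Classical in - ∑ a with π a = i ∧ a ≠ p i, C (g a) * X a

/-- The family of variables, those with index `p i` being replaced by `genericComb i`. -/
def genericFamily (a : ι) : MvPolynomial ι D :=
  open Classical in if a = p (π a) then genericComb π p g (π a) else X a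

/-- The variables that are not replaced in `genericFamily`. -/
def freeVars : Set (MvPolynomial ι D) := X '' {a | a ≠ p (π a)}

variable {π p}

theorem range_genericFamily (hp : ∀ i, π (p i) = i) : Set.range (genericFamily π p g) =
    freeVars π p ∪ Set.range (genericComb π p g) := by
  apply Set.Subset.antisymm
  · rintro _ ⟨a, rfl⟩
    unfold genericFamily
    split_ifs with h
    · exact Or.inr ⟨_, rfl⟩
    · exact Or.inl ⟨a, h, rfl⟩
  · rintro _ (⟨a, ha, rfl⟩ | ⟨i, rfl⟩)
    · exact ⟨a, if_neg ha⟩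
    · refine ⟨p i, ?_⟩
      rw [genericFamily, if_pos (by rw [hp]), hp]

/-- The automorphism `X a ↦ X a + d` of a polynomial ring. -/
def shiftVar (a : ι) (d : D) : MvPolynomial ι D →ₐ[D] MvPolynomial ι D :=
  open Classical in aeval fun b => X b + if b = a then C d else 0

theorem shiftVar_injective (a : ι) (d : D) : Function.Injective (shiftVar a d) := by
  classical
  have hinv : (shiftVar a (-d)).comp (shiftVar a d) = AlgHom.id D _ := by
    ext1 b
    by_cases hb : b = a <;> simp [shiftVar, hb]
  exact Function.LeftInverse.injective (g := shiftVar a (-d)) fun x => DFunLike.congr_fun hinv x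

/-- The combination is linear in `X a` with coefficient `-g a`, so a unit translation isolates that
coefficient. -/
theorem shiftVar_genericComb_self {i : Fin k} {a : ι} (ha : π a = i) (hap : a ≠ p i) :
    shiftVar a 1 (genericComb π p g i) = genericComb π p g i - C (g a) := by
  classical
  have h3 : ∀ b, shiftVar a 1 (C (g b) * X b) =
      C (g b) * X b + if b = a then C (g a) else 0 := fun b => by
    by_cases hb : b = a
    · subst hb
      simp [shiftVar, mul_add, algebraMap_eq]
    · simp [shiftVar, algebraMap_eq, hb]
  rw [genericComb, map_neg, map_sum, Finset.sum_congr rfl fun b _ => h3 b, Finset.sum_add_distrib,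
    Finset.sum_ite_eq', if_pos (by simp [ha, hap]), neg_add, sub_eq_add_neg]

theorem shiftVar_genericComb_of_ne {j : Fin k} {a : ι} (ha : π a ≠ j) :
    shiftVar a 1 (genericComb π p g j) = genericComb π p g j := by
  classical
  have h3 : ∀ b, π b = j → shiftVar a 1 (C (g b) * X b) = C (g b) * X b := fun b hb => by
    have : b ≠ a := fun h => ha (h ▸ hb)
    simp [shiftVar, algebraMap_eq, this]
  rw [genericComb, map_neg, map_sum]
  exact congrArg _ (Finset.sum_congr rfl fun b hb => h3 b (Finset.mem_filter.1 hb).2.1)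

/-- Translating `X a` by 1 maps the generators of the closure into it and fixes every combination
other than the `i`-th. Thus both the `i`-th combination and its translate lie in the closure, and
their difference is `C (g a)`. -/
theorem mem_algCl_of_genericComb_mem {J : Set (Fin k)} {i : Fin k} (hi : i ∉ J)
    (h : genericComb π p g i ∈ algCl (freeVars π p ∪ genericComb π p g '' J)) {a : ι}
    (ha : π a = i) (hap : a ≠ p i) :
    C (g a) ∈ algCl (freeVars π p ∪ genericComb π p g '' J) := by
  set S := freeVars π p ∪ genericComb π p g '' J with hS
  have h1 := algHom_mem_algCl ((shiftVar a (1 : D)).restrictScalars ℂ) (shiftVar_injective a 1) h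
  have h2 : ((shiftVar a (1 : D)).restrictScalars ℂ) '' S ⊆ algCl S := by
    rintro _ ⟨_, (⟨b, hb, rfl⟩ | ⟨j, hj, rfl⟩), rfl⟩
    · rw [AlgHom.restrictScalars_apply, shiftVar, aeval_X]
      refine (algCl S).add_mem (subset_algCl _ (Or.inl ⟨b, hb, rfl⟩)) ?_
      split_ifs
      · rw [C_1]
        exact (algCl S).one_mem
      · exact (algCl S).zero_mem
    · rw [AlgHom.restrictScalars_apply,
        shiftVar_genericComb_of_ne g (fun h => hi (ha.symm.trans h ▸ hj))]
      exact subset_algCl _ (Or.inr ⟨j, hj, rfl⟩)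
  have h3 := algCl_le h2 h1
  rw [AlgHom.restrictScalars_apply, shiftVar_genericComb_self g ha hap] at h3
  have h4 := (algCl S).sub_mem h h3
  rwa [sub_sub_cancel] at h4

theorem encard_freeVars (hp : ∀ i, π (p i) = i) :
    {a | a ≠ p (π a)}.encard + k = Fintype.card ι := by
  have hinj : Function.Injective p := Function.LeftInverse.injective hp
  have h1 : {a | a ≠ p (π a)} = (Set.range p)ᶜ := by
    ext a
    refine not_congr ⟨fun h => ⟨_, h.symm⟩, ?_⟩
    rintro ⟨i, rfl⟩
    rw [hp]
  have h2 : (Set.range p).encard = k := by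
    rw [← Set.image_univ, hinj.encard_image]
    simp
  rw [h1, ← h2, add_comm, Set.encard_add_encard_compl]
  simp

/-- With n indices, the count is (n - k) free variables, plus rk(g_J), plus at most k - |J| for the
combinations outside `J`; those inside are polynomials in what has been adjoined. -/
theorem algRank_genericFamily_le (hp : ∀ i, π (p i) = i)
    (J : Finset (Fin k)) :
    algRank (Set.range (genericFamily π p g)) + J.card ≤
      algRank (g '' {a | π a ∈ J}) + Fintype.card ι := by
  classical
  have h1 : algRank (Set.range (genericFamily π p g)) ≤
      algRank ((freeVars π p ∪ C '' (g '' {a | π a ∈ J})) ∪ genericComb π p g '' (J : Set (Fin k))ᶜ) := by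
    apply algRank_mono
    rw [range_genericFamily g hp]
    set S := (freeVars π p ∪ C '' (g '' {a | π a ∈ J})) ∪ genericComb π p g '' (J : Set (Fin k))ᶜ
    rintro _ (h | ⟨i, rfl⟩)
    · exact subset_algCl _ (Or.inl (Or.inl h))
    · by_cases hi : i ∈ J
      · refine (algCl S).neg_mem ((algCl S).sum_mem fun a ha => ?_)
        obtain ⟨rfl, ha⟩ := (Finset.mem_filter.1 ha).2
        refine (algCl S).mul_mem ?_ ?_
        · exact subset_algCl _ (Or.inl (Or.inr ⟨_, ⟨a, hi, rfl⟩, rfl⟩))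
        · exact subset_algCl _ (Or.inl (Or.inl ⟨a, ha, rfl⟩))
      · exact subset_algCl _ (Or.inr ⟨i, hi, rfl⟩)
  have h2 : (genericComb π p g '' (J : Set (Fin k))ᶜ).encard + J.card ≤ k := by
    have := Set.encard_add_encard_compl (J : Set (Fin k))
    rw [Set.encard_coe_eq_coe_finsetCard] at this
    calc _ ≤ (J : Set (Fin k))ᶜ.encard + J.card := by gcongr; exact Set.encard_image_le _ _
      _ = k := by rw [add_comm, this]; simp
  calc _ ≤ {a | a ≠ p (π a)}.encard + algRank (g '' {a | π a ∈ J}) +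
        (genericComb π p g '' (J : Set (Fin k))ᶜ).encard + J.card := by
        gcongr
        refine h1.trans ((algRank_union_le _ _).trans (add_le_add ?_ (algRank_le_encard _)))
        exact (algRank_X_union_C _ _).le
    _ ≤ {a | a ≠ p (π a)}.encard + algRank (g '' {a | π a ∈ J}) + k := by
        rw [add_assoc _ _ (J.card : ℕ∞)]; gcongr
    _ = _ := by rw [← encard_freeVars hp]; ring

/-- The set `J` attaining the minimum is what is left when no further combination is independent of
the remaining ones. -/
theorem exists_le_algRank_genericFamily (hp : ∀ i, π (p i) = i) (hg : ∀ i, g (p i) = 1) :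
    ∃ J : Finset (Fin k), algRank (g '' {a | π a ∈ J}) + Fintype.card ι ≤
      algRank (Set.range (genericFamily π p g)) + J.card := by
  classical
  let r : Finset (Fin k) → ℕ∞ := fun J => algRank (freeVars π p ∪ genericComb π p g '' (J : Set (Fin k)))
  set ρ := algRank (Set.range (genericFamily π p g)) with hρ
  -- The full set satisfies the condition with equality. Removing a combination outside the closure
  -- of the rest lowers both sides by one, so a smallest `J` admits no such removal.
  obtain ⟨J, hJ, hmin⟩ := (Finset.univ.filter fun J => r J + k ≤ ρ + J.card).exists_min_image
    Finset.card ⟨Finset.univ, by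
      simp [r, hρ, range_genericFamily g hp]⟩
  rw [Finset.mem_filter] at hJ
  have hcl : ∀ i ∈ J, genericComb π p g i ∈
      algCl (freeVars π p ∪ genericComb π p g '' (J.erase i : Set (Fin k))) := fun i hi => by
    by_contra hcon
    have h1 := algRank_insert hcon
    rw [← Set.union_insert, ← Set.image_insert_eq, ← Finset.coe_insert, Finset.insert_erase hi] at h1
    have h2 : r J = r (J.erase i) + 1 := h1
    have h3 := hJ.2
    have h4 : (J.card : ℕ∞) = (J.erase i).card + 1 := by
      rw [← Finset.card_erase_add_one hi]; rfl
    rw [h2, h4, add_right_comm, ← add_assoc] at h3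
    have h5 := hmin (J.erase i) (Finset.mem_filter.2 ⟨Finset.mem_univ _,
      (WithTop.add_le_add_iff_right ENat.one_ne_top).1 h3⟩)
    exact absurd (Finset.card_erase_lt_of_mem hi) (not_lt.2 h5)
  refine ⟨J, ?_⟩
  have h6 : algRank (freeVars π p ∪ C '' (g '' {a | π a ∈ J})) ≤ r J := by
    apply algRank_mono
    rintro _ (h | ⟨_, ⟨a, ha, rfl⟩, rfl⟩)
    · exact subset_algCl _ (Or.inl h)
    -- The translation argument says nothing about the omitted index; there the normalisation `g (p
    -- i) = 1` is needed.
    · by_cases hap : a = p (π a)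
      · rw [hap, hg, C_1]
        exact (algCl _).one_mem
      · exact algCl_mono (Set.union_subset_union_right _ (Set.image_mono
          (by simp)))
          (mem_algCl_of_genericComb_mem g (by simp) (hcl _ ha) rfl hap)
  refine le_trans ?_ hJ.2
  calc _ = ({a | a ≠ p (π a)}.encard + algRank (g '' {a | π a ∈ J})) + k := by
        rw [← encard_freeVars hp]; ring
    _ ≤ _ := by
        gcongr
        exact (algRank_X_union_C _ _).symm.le.trans h6

end Generic

/-! ### Polynomial functions and regular functions -/

section PolyEval

variable {V : Type*} [AddCommGroup V] [Module ℂ V]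

theorem eval_smul_of_isHomogeneous {σ : Type*} {p : MvPolynomial σ ℂ} {d : ℕ}
    (hp : p.IsHomogeneous d) (c : ℂ) (x : σ → ℂ) :
    MvPolynomial.eval (c • x) p = c ^ d * MvPolynomial.eval x p := by
  rw [MvPolynomial.eval_eq, MvPolynomial.eval_eq, Finset.mul_sum]
  refine Finset.sum_congr rfl fun e he => ?_
  have hd : ∑ i ∈ e.support, e i = d := by
    have := hp (MvPolynomial.mem_support_iff.1 he)
    rwa [show (1 : σ → ℕ) = fun _ => 1 from rfl, ← Finsupp.degree_eq_weight_one] at this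
  simp only [Pi.smul_apply, smul_eq_mul, mul_pow, Finset.prod_mul_distrib]
  rw [Finset.prod_pow_eq_pow_sum, hd]
  ring

theorem polyEval_smul {p : MvPolynomial (Module.Dual ℂ V) ℂ} {d : ℕ} (hp : p.IsHomogeneous d)
    (c : ℂ) (v : V) : polyEval p (c • v) = c ^ d * polyEval p v := by
  have : (fun φ : Module.Dual ℂ V => φ (c • v)) = c • fun φ : Module.Dual ℂ V => φ v := by
    ext φ; simp
  rw [polyEval, this, eval_smul_of_isHomogeneous hp]; rfl

theorem polyEval_rep_mk {p : MvPolynomial (Module.Dual ℂ V) ℂ} {d : ℕ} (hp : p.IsHomogeneous d)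
    {v : V} (hv : v ≠ 0) : polyEval p (Projectivization.mk ℂ v hv).rep ≠ 0 ↔ polyEval p v ≠ 0 := by
  obtain ⟨a, ha⟩ := Projectivization.exists_smul_eq_mk_rep ℂ v hv
  rw [← ha, Units.smul_def, polyEval_smul hp, mul_ne_zero_iff]
  exact and_iff_right (pow_ne_zero _ a.ne_zero)

theorem exists_polyEval_of_isOpen {O : Set V} (hO : IsOpen[affineZariski V] O) :
    ∀ x ∈ O, ∃ p : MvPolynomial (Module.Dual ℂ V) ℂ,
      polyEval p x ≠ 0 ∧ ∀ y : V, polyEval p y ≠ 0 → y ∈ O := by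
  induction hO with
  | basic s hs =>
    obtain ⟨p, rfl⟩ := hs
    exact fun x hx => ⟨p, hx, fun y hy => hy⟩
  | univ => exact fun x _ => ⟨1, by simp [polyEval], fun y _ => trivial⟩
  | inter s t _ _ hs ht =>
    rintro x ⟨hxs, hxt⟩
    obtain ⟨p, h1, h2⟩ := hs x hxs
    obtain ⟨q, h3, h4⟩ := ht x hxt
    refine ⟨p * q, ?_, fun y hy => ?_⟩
    · rw [polyEval, map_mul]
      exact mul_ne_zero h1 h3
    · rw [polyEval, map_mul] at hy
      exact ⟨h2 y (left_ne_zero_of_mul hy), h4 y (right_ne_zero_of_mul hy)⟩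
  | sUnion S _ hS =>
    rintro x ⟨s, hs, hx⟩
    obtain ⟨p, h1, h2⟩ := hS s hs x hx
    exact ⟨p, h1, fun y hy => ⟨s, hs, h2 y hy⟩⟩

theorem exists_homogeneous_of_isOpen {O : Set (ℙ ℂ V)} (hO : IsOpen[projZariski V] O) :
    ∀ x ∈ O, ∃ (d : ℕ) (p : MvPolynomial (Module.Dual ℂ V) ℂ), p.IsHomogeneous d ∧
      polyEval p x.rep ≠ 0 ∧ ∀ y : ℙ ℂ V, polyEval p y.rep ≠ 0 → y ∈ O := by
  induction hO with
  | basic s hs =>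
    obtain ⟨d, p, hp, rfl⟩ := hs
    exact fun x hx => ⟨d, p, hp, hx, fun y hy => hy⟩
  | univ =>
    exact fun x _ => ⟨0, 1, MvPolynomial.isHomogeneous_one _ _, by simp [polyEval],
      fun y _ => trivial⟩
  | inter s t _ _ hs ht =>
    rintro x ⟨hxs, hxt⟩
    obtain ⟨d, p, hp, h1, h2⟩ := hs x hxs
    obtain ⟨e, q, hq, h3, h4⟩ := ht x hxt
    refine ⟨d + e, p * q, hp.mul hq, ?_, fun y hy => ?_⟩
    · rw [polyEval, map_mul]
      exact mul_ne_zero h1 h3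
    · rw [polyEval, map_mul] at hy
      exact ⟨h2 y (left_ne_zero_of_mul hy), h4 y (right_ne_zero_of_mul hy)⟩
  | sUnion S _ hS =>
    rintro x ⟨s, hs, hx⟩
    obtain ⟨d, p, hp, h1, h2⟩ := hS s hs x hx
    exact ⟨d, p, hp, h1, fun y hy => ⟨s, hs, h2 y hy⟩⟩

theorem isOpen_polyEval_ne_zero {p : MvPolynomial (Module.Dual ℂ V) ℂ} {d : ℕ}
    (hp : p.IsHomogeneous d) : IsOpen[projZariski V] {x | polyEval p x.rep ≠ 0} :=
  TopologicalSpace.isOpen_generateFrom_of_mem ⟨d, p, hp, rfl⟩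

end PolyEval

/-! ### Regular functions and affine neighbourhoods -/

namespace QPVariety

variable {V : Type u} [AddCommGroup V] [Module ℂ V] {X : QPVariety V}

theorem isOpen_homEval_ne_zero {p : MvPolynomial (Module.Dual ℂ V) ℂ} {d : ℕ}
    (hp : p.IsHomogeneous d) : IsOpen[X.zariski] {x : X.Pt | homEval p x ≠ 0} :=
  ⟨_, isOpen_polyEval_ne_zero hp, rfl⟩

theorem exists_homEval_of_isOpen {O : Set X.Pt} (hO : IsOpen[X.zariski] O) {x : X.Pt} (hx : x ∈ O) :
    ∃ (d : ℕ) (p : MvPolynomial (Module.Dual ℂ V) ℂ), p.IsHomogeneous d ∧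
      homEval p x ≠ 0 ∧ ∀ y : X.Pt, homEval p y ≠ 0 → y ∈ O := by
  obtain ⟨O', hO', rfl⟩ := hO
  obtain ⟨d, p, hp, h1, h2⟩ := exists_homogeneous_of_isOpen hO' x.1 hx
  exact ⟨d, p, hp, h1, fun y hy => h2 y.1 hy⟩

theorem nonempty_inter_of_isOpen {O W : Set X.Pt} (hO : IsOpen[X.zariski] O)
    (hW : IsOpen[X.zariski] W) (hO' : O.Nonempty) (hW' : W.Nonempty) : (O ∩ W).Nonempty := by
  obtain ⟨O', hO, rfl⟩ := hO
  obtain ⟨W', hW, rfl⟩ := hW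
  obtain ⟨x, hx⟩ := hO'
  obtain ⟨y, hy⟩ := hW'
  obtain ⟨z, hz, hzO, hzW⟩ := X.irreducible.2 O' W' hO hW ⟨x.1, x.2, hx⟩ ⟨y.1, y.2, hy⟩
  exact ⟨⟨z, hz⟩, hzO, hzW⟩

theorem isOpen_of_forall_exists {O : Set X.Pt}
    (h : ∀ x ∈ O, ∃ W, IsOpen[X.zariski] W ∧ x ∈ W ∧ W ⊆ O) : IsOpen[X.zariski] O :=
  (@isOpen_iff_forall_mem_open _ X.zariski _).2 fun x hx => by
    obtain ⟨W, h1, h2, h3⟩ := h x hx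
    exact ⟨W, h3, h1, h2⟩

variable {U : Set X.Pt}

theorem IsRegular.const (c : ℂ) : IsRegular (fun _ : U => c) := by
  intro x
  refine ⟨Set.univ, @isOpen_univ _ X.zariski, trivial, 0, MvPolynomial.C c, 1,
    MvPolynomial.isHomogeneous_C _ _, MvPolynomial.isHomogeneous_one _ _, fun y _ => ?_⟩
  simp [homEval, polyEval]

theorem IsRegular.mul {f g : U → ℂ} (hf : IsRegular f) (hg : IsRegular g) : IsRegular (f * g) := by
  have := IsRegular.prod (ι := Bool) (U := fun _ => U) (f := fun b => cond b f g)
    (fun b => by cases b <;> assumption) (U' := U) fun _ => subset_rfl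
  simpa [Pi.mul_def] using this

theorem IsRegular.inv {f : U → ℂ} (hf : IsRegular f) (h0 : ∀ x, f x ≠ 0) : IsRegular f⁻¹ := by
  intro x
  obtain ⟨W, hW, hx, d, p, q, hp, hq, h⟩ := hf x
  refine ⟨W, hW, hx, d, q, p, hq, hp, fun y hy => ?_⟩
  obtain ⟨h1, h2⟩ := h y hy
  refine ⟨fun h3 => h0 y (by rw [h2, h3, zero_div]), ?_⟩
  rw [Pi.inv_apply, h2, inv_div]

theorem IsRegular.restrict {f : U → ℂ} (hf : IsRegular f) {U' : Set X.Pt} (h : U' ⊆ U) :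
    IsRegular fun x : U' => f ⟨x.1, h x.2⟩ := by
  intro x
  obtain ⟨W, hW, hx, d, p, q, hp, hq, h'⟩ := hf ⟨x.1, h x.2⟩
  exact ⟨W, hW, hx, d, p, q, hp, hq, fun y hy => h' ⟨y.1, h y.2⟩ hy⟩

/-- The algebra of regular functions on `U`. -/
def regularSubalgebra (U : Set X.Pt) : Subalgebra ℂ (U → ℂ) where
  carrier := {f | IsRegular f}
  mul_mem' hf hg := hf.mul hg
  add_mem' hf hg := hf.add hg
  algebraMap_mem' c := IsRegular.const c

theorem mem_regularSubalgebra {f : U → ℂ} : f ∈ regularSubalgebra U ↔ IsRegular f := Iff.rfl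

theorem IsRegular.eval {m : Type*} {f : m → U → ℂ} (hf : ∀ i, IsRegular (f i))
    (P : MvPolynomial m ℂ) : IsRegular fun x => MvPolynomial.eval (fun i => f i x) P := by
  have h : MvPolynomial.aeval f P ∈ regularSubalgebra U :=
    (Algebra.adjoin_le (by rintro _ ⟨i, rfl⟩; exact hf i) : Algebra.adjoin ℂ (Set.range f) ≤ _)
      (MvPolynomial.aeval_range (R := ℂ) f ▸ ⟨P, rfl⟩)
  convert (mem_regularSubalgebra.1 h) using 1
  ext x
  rw [← MvPolynomial.coe_aeval_eq_eval]
  exact (DFunLike.congr_fun (MvPolynomial.comp_aeval f (Pi.evalAlgHom ℂ (fun _ : U => ℂ) x)) P).symm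

theorem IsRegular.isOpen_ne_zero (hU : IsOpen[X.zariski] U) {f : U → ℂ} (hf : IsRegular f) :
    IsOpen[X.zariski] {x | ∃ h : x ∈ U, f ⟨x, h⟩ ≠ 0} := by
  refine isOpen_of_forall_exists fun x hx => ?_
  obtain ⟨hxU, hfx⟩ := hx
  obtain ⟨W, hW, hx, d, p, q, hp, hq, h'⟩ := hf ⟨x, hxU⟩
  refine ⟨(W ∩ U) ∩ {y | homEval p y ≠ 0}, @IsOpen.inter _ X.zariski _ _
    (@IsOpen.inter _ X.zariski _ _ hW hU) (isOpen_homEval_ne_zero hp), ⟨⟨hx, hxU⟩, fun h => ?_⟩, ?_⟩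
  · exact hfx (by rw [(h' _ hx).2, h, zero_div])
  · rintro y ⟨⟨hyW, hyU⟩, hy⟩
    refine ⟨hyU, ?_⟩
    rw [(h' ⟨y, hyU⟩ hyW).2]
    exact div_ne_zero hy (h' ⟨y, hyU⟩ hyW).1

/-- Every point of `X` has arbitrarily small affine neighbourhoods, on which finitely many given
regular functions belong to the coordinate ring `B`. -/
theorem exists_affine_nhd [FiniteDimensional ℂ V] {N : Set X.Pt} (hN : IsOpen[X.zariski] N)
    {x₀ : X.Pt} (hx₀ : x₀ ∈ N) {m : Type*} [Finite m] (f : m → N → ℂ) (hf : ∀ i, IsRegular (f i)) :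
    ∃ (U : Set X.Pt) (hUN : U ⊆ N) (B : Subalgebra ℂ (U → ℂ)), IsOpen[X.zariski] U ∧ x₀ ∈ U ∧
      B.FG ∧ (∀ b ∈ B, IsRegular b) ∧ (∀ i, (fun x : U => f i ⟨x.1, hUN x.2⟩) ∈ B) ∧
      ∀ ψ : B →ₐ[ℂ] ℂ, ∃ x : U, ∀ b : B, ψ b = b.1 x := by
  classical
  obtain ⟨_⟩ := nonempty_fintype m
  choose W hW hxW e p q hp hq hpq using fun i => hf i ⟨x₀, hx₀⟩
  obtain ⟨O, Z, hO, hZ, hX⟩ := X.locallyClosed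
  have hOX : IsOpen[X.zariski] ((fun x : X.Pt => x.1) ⁻¹' O) := ⟨O, hO, rfl⟩
  have hx₀O : x₀.1 ∈ O := (hX ▸ x₀.2 : x₀.1 ∈ O ∩ Z).1
  obtain ⟨d₁, h₁, hh₁, hx₁, hO₁⟩ := exists_homogeneous_of_isOpen hO x₀.1 hx₀O
  obtain ⟨d₂, h₂, hh₂, hx₂, hN₂⟩ := exists_homEval_of_isOpen
    (@IsOpen.inter _ X.zariski _ _ hN (@isOpen_iInter_of_finite _ _ X.zariski _ _ hW))
    ⟨hx₀, Set.mem_iInter.2 hxW⟩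
  obtain ⟨ℓ, hℓ⟩ : ∃ ℓ : Module.Dual ℂ V, ℓ x₀.1.rep ≠ 0 := by
    by_contra! h
    exact x₀.1.rep_nonzero ((Module.forall_dual_apply_eq_zero_iff ℂ _).1 h)
  -- the equation of the complement of the neighbourhood
  set H := h₁ * h₂ * MvPolynomial.X ℓ * ∏ i, q i with hH
  have hHd : H.IsHomogeneous (d₁ + d₂ + 1 + ∑ i, e i) :=
    ((hh₁.mul hh₂).mul (MvPolynomial.isHomogeneous_X ℂ ℓ)).mul
      (MvPolynomial.IsHomogeneous.prod _ _ _ fun i _ => hq i)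
  set D := d₁ + d₂ + 1 + ∑ i, e i
  have hdvd : ∀ (P : MvPolynomial (Module.Dual ℂ V) ℂ) (v : V), P ∣ H → polyEval H v ≠ 0 →
      polyEval P v ≠ 0 := fun P v ⟨Q, hQ⟩ hv h0 => hv (by
    rw [hQ, polyEval, map_mul, show MvPolynomial.eval _ P = 0 from h0, zero_mul])
  have hd₁ : h₁ ∣ H := by rw [hH, mul_assoc, mul_assoc]; exact dvd_mul_right _ _
  have hd₂ : h₂ ∣ H := by rw [hH, mul_comm h₁, mul_assoc, mul_assoc]; exact dvd_mul_right _ _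
  have hdℓ : MvPolynomial.X ℓ ∣ H := by rw [hH, mul_right_comm]; exact dvd_mul_left _ _
  have hdq : ∀ i, q i ∣ H := fun i =>
    (Finset.dvd_prod_of_mem q (Finset.mem_univ i)).trans (dvd_mul_left _ _)
  let U : Set X.Pt := {x | homEval H x ≠ 0}
  have hU : ∀ x ∈ U, x ∈ N ∧ ∀ i, x ∈ W i := fun x hx => by
    have := hN₂ x (hdvd h₂ _ hd₂ hx)
    exact ⟨this.1, Set.mem_iInter.1 this.2⟩
  have hUN : U ⊆ N := fun x hx => (hU x hx).1
  have hUℓ : ∀ x : U, ℓ x.1.1.rep ≠ 0 := fun x => by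
    simpa [polyEval] using hdvd _ _ hdℓ x.2
  -- normalised representatives
  let v : U → V := fun x => (ℓ x.1.1.rep)⁻¹ • x.1.1.rep
  have hv : ∀ x : U, polyEval H (v x) ≠ 0 := fun x => by
    rw [polyEval_smul hHd]
    exact mul_ne_zero (pow_ne_zero _ (inv_ne_zero (hUℓ x))) x.2
  let b := Module.finBasis ℂ V
  let u : U → ℂ := fun x => (polyEval H (v x))⁻¹
  let B : Subalgebra ℂ (U → ℂ) :=
    Algebra.adjoin ℂ (Set.range (fun i x => b.coord i (v x)) ∪ {u})
  have hcoord : ∀ i, (fun x => b.coord i (v x)) ∈ B := fun i =>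
    Algebra.subset_adjoin (Or.inl ⟨i, rfl⟩)
  have huB : u ∈ B := Algebra.subset_adjoin (Or.inr rfl)
  have hdual : ∀ φ : Module.Dual ℂ V, (fun x => φ (v x)) = ∑ i, φ (b i) • fun x => b.coord i (v x) :=
    fun φ => by
      ext x
      conv_lhs => rw [← b.sum_repr (v x), map_sum]
      simp [mul_comm]
  have hdualB : ∀ φ : Module.Dual ℂ V, (fun x => φ (v x)) ∈ B := fun φ => by
    rw [hdual]
    exact B.sum_mem fun i _ => B.smul_mem (hcoord i) _
  let V' : Module.Dual ℂ V → B := fun φ => ⟨fun x => φ (v x), hdualB φ⟩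
  have hpoly : ∀ P : MvPolynomial (Module.Dual ℂ V) ℂ,
      ((MvPolynomial.aeval V' P : B) : U → ℂ) = fun x => polyEval P (v x) := fun P => by
    ext x
    have := DFunLike.congr_fun (MvPolynomial.comp_aeval V'
      ((Pi.evalAlgHom ℂ (fun _ : U => ℂ) x).comp B.val)) P
    rw [polyEval, ← MvPolynomial.coe_aeval_eq_eval]
    exact this
  have hpolyB : ∀ P : MvPolynomial (Module.Dual ℂ V) ℂ, (fun x => polyEval P (v x)) ∈ B :=
    fun P => hpoly P ▸ (MvPolynomial.aeval V' P : B).2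
  refine ⟨U, hUN, B, isOpen_homEval_ne_zero hHd, ?_, ?_, ?_, ?_, ?_⟩
  · change polyEval H _ ≠ 0
    rw [hH, polyEval, map_mul, map_mul, map_mul, map_prod, MvPolynomial.eval_X]
    exact mul_ne_zero (mul_ne_zero (mul_ne_zero hx₁ hx₂) hℓ)
      (Finset.prod_ne_zero_iff.2 fun i _ => (hpq i ⟨x₀, hx₀⟩ (hxW i)).1)
  · exact ⟨((Set.finite_range fun i x => b.coord i (v x)).union
      (Set.finite_singleton u)).toFinset, by rw [Set.Finite.coe_toFinset]⟩
  · suffices B ≤ regularSubalgebra U from fun b hb => this hb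
    refine Algebra.adjoin_le ?_
    rintro _ (⟨i, rfl⟩ | rfl) x
    · refine ⟨U, isOpen_homEval_ne_zero hHd, x.2, 1, .X (b.coord i), .X ℓ,
        MvPolynomial.isHomogeneous_X _ _, MvPolynomial.isHomogeneous_X _ _, fun y _ => ⟨?_, ?_⟩⟩
      · simpa [homEval, polyEval] using hUℓ y
      · simp only [homEval, polyEval, MvPolynomial.eval_X, v, map_smul, smul_eq_mul]
        rw [inv_mul_eq_div]
    -- The inverse of `H` on normalised representatives is the degree-zero quotient `ℓ ^ D / H`.
    · refine ⟨U, isOpen_homEval_ne_zero hHd, x.2, D, .X ℓ ^ D, H, ?_, hHd, fun y _ => ⟨y.2, ?_⟩⟩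
      · simpa using (MvPolynomial.isHomogeneous_X ℂ ℓ).pow D
      · simp only [u, v]
        have hX : homEval (MvPolynomial.X ℓ ^ D) y.1 = ℓ y.1.1.rep ^ D := by
          rw [homEval, polyEval, map_pow, MvPolynomial.eval_X]
        rw [polyEval_smul hHd, mul_inv, inv_pow, inv_inv, div_eq_mul_inv, hX]
        rfl
  · intro i
    obtain ⟨Q, hQ⟩ := hdq i
    -- Since `H = q i * Q`, the quotient `p i / q i` equals `p i * Q / H`.
    have : (fun x : U => f i ⟨x.1, hUN x.2⟩) =
        (fun x => polyEval (p i) (v x)) * (fun x => polyEval Q (v x)) * u := by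
      ext x
      have hq0 : polyEval (q i) x.1.1.rep ≠ 0 := hdvd _ _ ⟨Q, hQ⟩ x.2
      have hq1 : polyEval (q i) (v x) ≠ 0 := hdvd _ _ ⟨Q, hQ⟩ (hv x)
      have hQ1 : polyEval Q (v x) ≠ 0 := hdvd _ _ ⟨q i, hQ.trans (mul_comm _ _)⟩ (hv x)
      have h1 : polyEval H (v x) = polyEval (q i) (v x) * polyEval Q (v x) := by
        rw [hQ, polyEval, map_mul]; rfl
      have h2 : polyEval (p i) x.1.1.rep / polyEval (q i) x.1.1.rep =
          polyEval (p i) (v x) / polyEval (q i) (v x) := by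
        simp only [v]
        rw [polyEval_smul (hp i), polyEval_smul (hq i),
          mul_div_mul_left _ _ (pow_ne_zero _ (inv_ne_zero (hUℓ x)))]
      rw [(hpq i ⟨x.1, hUN x.2⟩ ((hU x.1 x.2).2 i)).2]
      simp only [Pi.mul_apply, u]
      rw [h1, homEval, homEval, h2]
      field_simp
    rw [this]
    exact B.mul_mem (B.mul_mem (hpolyB _) (hpolyB _)) huB
  · intro ψ
    -- `z` has as coordinates the values of `ψ` on the normalised coordinate functions, so `ψ` acts
    -- on polynomial functions as evaluation at `z`. It remains to see that the line of `z` is a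
    -- point of `U` with normalised representative `z`.
    let z : V := ∑ i, ψ ⟨_, hcoord i⟩ • b i
    have hz : ∀ φ : Module.Dual ℂ V, φ z = ψ (V' φ) := fun φ => by
      have : V' φ = ∑ i, φ (b i) • (⟨_, hcoord i⟩ : B) := Subtype.ext (by
        rw [AddSubmonoidClass.coe_finsetSum]
        exact hdual φ)
      rw [this, map_sum, map_sum]
      refine Finset.sum_congr rfl fun i _ => ?_
      rw [map_smul, map_smul, smul_eq_mul, smul_eq_mul, mul_comm]
    have hzP : ∀ P : MvPolynomial (Module.Dual ℂ V) ℂ, polyEval P z = ψ (MvPolynomial.aeval V' P) :=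
      fun P => by
        rw [polyEval, show (fun φ : Module.Dual ℂ V => φ z) = fun φ => ψ (V' φ) from funext hz,
          ← MvPolynomial.coe_aeval_eq_eval]
        exact (DFunLike.congr_fun (MvPolynomial.comp_aeval V' ψ) P).symm
    have hzH : ψ ⟨u, huB⟩ * polyEval H z = 1 := by
      rw [hzP, ← map_mul, ← map_one ψ]
      congr 1
      apply Subtype.ext
      rw [Subalgebra.coe_mul, hpoly]
      ext x
      exact inv_mul_cancel₀ (hv x)
    have hzH0 : polyEval H z ≠ 0 := right_ne_zero_of_mul_eq_one hzH
    have hzℓ : ℓ z = 1 := by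
      rw [hz, ← map_one ψ]
      congr 1
      apply Subtype.ext
      ext x
      simp only [V', v, map_smul, smul_eq_mul, Subalgebra.coe_one, Pi.one_apply]
      exact inv_mul_cancel₀ (hUℓ x)
    have hz0 : z ≠ 0 := fun h => by simp [h] at hzℓ
    have hmem : Projectivization.mk ℂ z hz0 ∈ X.carrier := by
      rw [hX]
      refine ⟨hO₁ _ ((polyEval_rep_mk hh₁ hz0).2 (hdvd _ _ hd₁ hzH0)), ?_⟩
      -- A form separating the line of `z` from `Z` vanishes on `U`, so it is zero in `B`; then `ψ`
      -- kills it, and it vanishes at `z`.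
      by_contra hcon
      obtain ⟨d, P, hP, hP1, hP2⟩ := exists_homogeneous_of_isOpen
        (@IsClosed.isOpen_compl _ (projZariski V) _ hZ) _ hcon
      refine (polyEval_rep_mk hP hz0).1 hP1 ?_
      rw [hzP, ← map_zero ψ]
      congr 1
      apply Subtype.ext
      rw [hpoly]
      ext x
      by_contra hne
      have hxZ : x.1.1 ∈ Z := (hX ▸ x.1.2 : x.1.1 ∈ O ∩ Z).2
      refine hP2 x.1.1 (fun h0 => hne ?_) hxZ
      simp only [v]
      rw [polyEval_smul hP, h0, mul_zero]; rfl
    let x : U := ⟨⟨_, hmem⟩, (polyEval_rep_mk hHd hz0).2 hzH0⟩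
    have hvx : v x = z := by
      obtain ⟨a, ha⟩ := Projectivization.exists_smul_eq_mk_rep ℂ z hz0
      simp only [v, x]
      rw [← ha, Units.smul_def, map_smul, hzℓ, smul_smul, smul_eq_mul, mul_one,
        inv_mul_cancel₀ a.ne_zero, one_smul]
    refine ⟨x, fun c => ?_⟩
    obtain ⟨c, hc⟩ := c
    induction hc using Algebra.adjoin_induction with
    | mem y hy =>
      obtain (⟨i, rfl⟩ | rfl) := hy
      · have := hz (b.coord i)
        change ψ (V' (b.coord i)) = b.coord i (v x)
        rw [← this, hvx]
      · change _ = (polyEval H (v x))⁻¹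
        rw [hvx]
        exact eq_inv_of_mul_eq_one_left hzH
    | algebraMap r => exact ψ.commutes r
    | add y y' hy hy' h h' =>
      change ψ ⟨y, hy⟩ = y x at h
      change ψ ⟨y', hy'⟩ = y' x at h'
      change _ = y x + y' x
      rw [← h, ← h', ← map_add]; rfl
    | mul y y' hy hy' h h' =>
      change ψ ⟨y, hy⟩ = y x at h
      change ψ ⟨y', hy'⟩ = y' x at h'
      change _ = y x * y' x
      rw [← h, ← h', ← map_mul]; rfl

end QPVariety

/-! ### Dimension and coordinates -/

/-- All members of a chain of irreducible closed sets above `Z` meet any open set that meets `Z`, so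
coheights can be computed in one member of the cover. -/
theorem topologicalKrullDim_le_of_cover {T : Type*} [TopologicalSpace T] {m : Type*} {O : m → Set T}
    (hO : ∀ i, IsOpen (O i)) (hc : ∀ t, ∃ i, t ∈ O i) {n : WithBot ℕ∞}
    (h : ∀ i, topologicalKrullDim (O i) ≤ n) : topologicalKrullDim T ≤ n := by
  rw [topologicalKrullDim, Order.krullDim_eq_iSup_coheight]
  refine iSup_le fun Z => ?_
  obtain ⟨t, ht⟩ := Z.isIrreducible.nonempty
  obtain ⟨i, hi⟩ := hc t
  have hf := (hO i).isOpenEmbedding_subtypeVal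
  let e := TopologicalSpace.IrreducibleCloseds.orderIsoOfIsOpenEmbedding _ hf
  have h1 : TopologicalSpace.IrreducibleCloseds.map _ hf.continuous (e.symm ⟨Z, ⟨t, hi⟩, ht⟩) = Z :=
    congrArg Subtype.val (e.apply_symm_apply ⟨Z, ⟨t, hi⟩, ht⟩)
  rw [← h1, hf.coheight_map]
  exact (Order.coheight_le_krullDim _).trans (h i)

/-- Clearing denominators by a power of `e` turns the relation in `K` into one in `B`, to which `χ`
applies. -/
theorem eval_div_eq_zero {m B K : Type*} [CommRing B] [IsDomain B] [Algebra ℂ B] [Field K]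
    [Algebra ℂ K] [Algebra B K] [IsScalarTower ℂ B K] [IsFractionRing B K] (χ : B →ₐ[ℂ] ℂ)
    (b : m → B) {e : B} (he : χ e ≠ 0) {P : MvPolynomial m ℂ}
    (h : MvPolynomial.aeval (fun j => algebraMap B K (b j) / algebraMap B K e) P = 0) :
    MvPolynomial.eval (fun j => χ (b j) / χ e) P = 0 := by
  have he0 : algebraMap B K e ≠ 0 := fun h0 => he (by
    rw [IsFractionRing.injective B K (h0.trans (map_zero _).symm), map_zero])
  have key : ∀ P : MvPolynomial m ℂ, ∃ (N : ℕ) (Q : B), algebraMap B K Q = algebraMap B K e ^ N *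
      MvPolynomial.aeval (fun j => algebraMap B K (b j) / algebraMap B K e) P ∧
      χ Q = χ e ^ N * MvPolynomial.eval (fun j => χ (b j) / χ e) P := fun P => by
    induction P using MvPolynomial.induction_on with
    | C r =>
      refine ⟨0, algebraMap ℂ B r, ?_, ?_⟩
      · rw [pow_zero, one_mul, MvPolynomial.aeval_C, ← IsScalarTower.algebraMap_apply]
      · rw [pow_zero, one_mul, MvPolynomial.eval_C, AlgHom.commutes]; rfl
    | add P P' h h' =>
      obtain ⟨N, Q, h1, h2⟩ := h
      obtain ⟨N', Q', h3, h4⟩ := h'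
      refine ⟨N + N', Q * e ^ N' + Q' * e ^ N, ?_, ?_⟩
      · simp only [map_add, map_mul, map_pow, h1, h3]; ring
      · simp only [map_add, map_mul, map_pow, h2, h4]; ring
    | mul_X P j h =>
      obtain ⟨N, Q, h1, h2⟩ := h
      refine ⟨N + 1, Q * b j, ?_, ?_⟩
      · simp only [map_mul, MvPolynomial.aeval_X, h1]; field_simp; ring
      · simp only [map_mul, MvPolynomial.eval_X, h2]; field_simp; ring
  obtain ⟨N, Q, h1, h2⟩ := key P
  rw [h, mul_zero] at h1
  rw [IsFractionRing.injective B K (h1.trans (map_zero _).symm), map_zero] at h2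
  exact (mul_eq_zero.1 h2.symm).resolve_left (pow_ne_zero _ he)

section Coordinates

variable {M : Type*} [AddCommGroup M] [Module ℂ M] {m : Type*} [Finite m]

/-- A polynomial in linear forms, expressed through the coordinates in a basis. -/
theorem exists_eval_repr_eq (β : Module.Basis m ℂ M) (p : MvPolynomial (Module.Dual ℂ M) ℂ) :
    ∃ P : MvPolynomial m ℂ, ∀ v, MvPolynomial.eval (fun i => β.repr v i) P = polyEval p v := by
  obtain ⟨_⟩ := nonempty_fintype m
  refine ⟨MvPolynomial.aeval (fun φ : Module.Dual ℂ M =>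
    ∑ i, MvPolynomial.C (φ (β i)) * MvPolynomial.X i) p, fun v => ?_⟩
  have h := DFunLike.congr_fun (MvPolynomial.comp_aeval (fun φ : Module.Dual ℂ M =>
    ∑ i, MvPolynomial.C (φ (β i)) * MvPolynomial.X i)
    (MvPolynomial.aeval (fun i => β.repr v i) : MvPolynomial m ℂ →ₐ[ℂ] ℂ)) p
  rw [← MvPolynomial.coe_aeval_eq_eval, polyEval, ← MvPolynomial.coe_aeval_eq_eval]
  have h1 : ∀ φ : Module.Dual ℂ M, (MvPolynomial.aeval (fun i => β.repr v i) :
      MvPolynomial m ℂ →ₐ[ℂ] ℂ) (∑ i, MvPolynomial.C (φ (β i)) * MvPolynomial.X i) = φ v :=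
    fun φ => by
      conv_rhs => rw [← β.sum_repr v, map_sum]
      simp [mul_comm]
  simp only [h1] at h
  exact h

theorem exists_polyEval_eq (β : Module.Basis m ℂ M) (P : MvPolynomial m ℂ) :
    ∃ p : MvPolynomial (Module.Dual ℂ M) ℂ,
      ∀ v, polyEval p v = MvPolynomial.eval (fun i => β.repr v i) P :=
  ⟨MvPolynomial.rename β.coord P, fun v => by
    rw [polyEval, MvPolynomial.eval_rename]; rfl⟩

theorem isInducing_specPt_affine (β : Module.Basis m ℂ M) {T : Type*} [TopologicalSpace T] {f : T → M}
    (hf : @Topology.IsInducing T M _ (affineZariski M) f) :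
    Topology.IsInducing fun t => specPt fun i => β.repr (f t) i := by
  let _ := affineZariski M
  refine isInducing_specPt (fun P => ?_) fun O hO t ht => ?_
  · obtain ⟨p, hp⟩ := exists_polyEval_eq β P
    refine hf.isOpen_iff.2 ⟨{v | polyEval p v ≠ 0},
      TopologicalSpace.isOpen_generateFrom_of_mem ⟨p, rfl⟩, ?_⟩
    ext t
    exact not_congr (by rw [hp])
  · obtain ⟨O', hO', rfl⟩ := hf.isOpen_iff.1 hO
    obtain ⟨p, h1, h2⟩ := exists_polyEval_of_isOpen hO' _ ht
    obtain ⟨P, hP⟩ := exists_eval_repr_eq β p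
    exact ⟨P, by rwa [hP], fun s hs => h2 _ (by rwa [hP] at hs)⟩

theorem isInducing_specPt_proj (β : Module.Basis m ℂ M) {T : Type*} [TopologicalSpace T]
    {f : T → ℙ ℂ (Module.Dual ℂ M)}
    (hf : @Topology.IsInducing T _ _ (projZariski (Module.Dual ℂ M)) f) (e : M)
    (he : ∀ t, (f t).rep e ≠ 0) :
    Topology.IsInducing fun t => specPt fun i => (f t).rep (β i) / (f t).rep e := by
  classical
  let _ := projZariski (Module.Dual ℂ M)
  have hscale : ∀ (p : MvPolynomial (Module.Dual ℂ (Module.Dual ℂ M)) ℂ) (d : ℕ),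
      p.IsHomogeneous d → ∃ P : MvPolynomial m ℂ, ∀ t, MvPolynomial.eval
        (fun i => (f t).rep (β i) / (f t).rep e) P ≠ 0 ↔ polyEval p (f t).rep ≠ 0 := by
    intro p d hp
    obtain ⟨P, hP⟩ := exists_eval_repr_eq β.dualBasis p
    refine ⟨P, fun t => ?_⟩
    have h1 := hP (((f t).rep e)⁻¹ • (f t).rep)
    rw [polyEval_smul hp] at h1
    have h2 : (fun i => β.dualBasis.repr (((f t).rep e)⁻¹ • (f t).rep) i) =
        fun i => (f t).rep (β i) / (f t).rep e := by
      ext i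
      rw [Module.Basis.dualBasis_repr, LinearMap.smul_apply, smul_eq_mul, inv_mul_eq_div]
    rw [← h2, h1, mul_ne_zero_iff]
    exact and_iff_right (pow_ne_zero _ (inv_ne_zero (he t)))
  refine isInducing_specPt (fun P => ?_) fun O hO t ht => ?_
  · let ev : M → Module.Dual ℂ (Module.Dual ℂ M) := Module.Dual.eval ℂ M
    -- This is the homogenisation of `P`, with evaluation at `e` as the extra variable.
    let p : MvPolynomial (Module.Dual ℂ (Module.Dual ℂ M)) ℂ :=
      ∑ n ∈ Finset.range (P.totalDegree + 1),
        MvPolynomial.rename (fun i => ev (β i)) (MvPolynomial.homogeneousComponent n P) *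
          MvPolynomial.X (ev e) ^ (P.totalDegree - n)
    have hp : p.IsHomogeneous P.totalDegree := by
      refine MvPolynomial.IsHomogeneous.sum _ _ _ fun n hn => ?_
      have h1 := ((MvPolynomial.homogeneousComponent_isHomogeneous n P).rename_isHomogeneous
        (f := fun i => ev (β i))).mul
        ((MvPolynomial.isHomogeneous_X ℂ (ev e)).pow (P.totalDegree - n))
      rwa [one_mul, Nat.add_sub_of_le (Nat.lt_succ_iff.1 (Finset.mem_range.1 hn))] at h1
    have hpe : ∀ w : Module.Dual ℂ M, w e ≠ 0 → polyEval p w =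
        (w e) ^ P.totalDegree * MvPolynomial.eval (fun i => w (β i) / w e) P := fun w hw => by
      have h3 : ∀ x, MvPolynomial.eval x P = ∑ n ∈ Finset.range (P.totalDegree + 1),
          MvPolynomial.eval x (MvPolynomial.homogeneousComponent n P) := fun x => by
        rw [← map_sum, MvPolynomial.sum_homogeneousComponent]
      rw [polyEval, map_sum, h3, Finset.mul_sum]
      refine Finset.sum_congr rfl fun n hn => ?_
      have h2 : (fun i => w (β i) / w e) = (w e)⁻¹ • fun i => w (β i) := by
        ext i
        rw [Pi.smul_apply, smul_eq_mul, inv_mul_eq_div]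
      rw [map_mul, map_pow, MvPolynomial.eval_X, MvPolynomial.eval_rename, h2,
        eval_smul_of_isHomogeneous (MvPolynomial.homogeneousComponent_isHomogeneous n P),
        inv_pow, ← mul_assoc, ← pow_sub₀ _ hw (Nat.lt_succ_iff.1 (Finset.mem_range.1 hn)), mul_comm]
      rfl
    refine hf.isOpen_iff.2 ⟨_, isOpen_polyEval_ne_zero hp, ?_⟩
    ext t
    change polyEval p (f t).rep ≠ 0 ↔ _
    rw [hpe _ (he t), mul_ne_zero_iff]
    exact and_iff_right (pow_ne_zero _ (he t))
  · obtain ⟨O', hO', rfl⟩ := hf.isOpen_iff.1 hO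
    obtain ⟨d, p, hp, h1, h2⟩ := exists_homogeneous_of_isOpen hO' _ ht
    obtain ⟨P, hP⟩ := hscale p d hp
    exact ⟨P, (hP t).2 h1, fun s hs => h2 _ ((hP s).1 hs)⟩

end Coordinates

/-! ### Sections near a point and on an affine open set -/

namespace LineBundle

variable {V : Type u} [AddCommGroup V] [Module ℂ V] {X : QPVariety V}

section SingleBundle

variable {L : LineBundle.{u, w} X}

theorem g_ne_zero {a b : L.ι} {x : X.Pt} (ha : x ∈ L.U a) (hb : x ∈ L.U b) :
    L.g a b ⟨x, ha, hb⟩ ≠ 0 := fun h => by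
  have := L.g_mul a b a x ha hb ha
  rw [h, zero_mul, L.g_self a x ha] at this
  exact zero_ne_one this

/-- The chosen representative and the chosen chart matter only up to a common nonzero scalar, so
ratios of values can be read in any chart. -/
theorem exists_kodaira_rep {F : Submodule ℂ L.H0} (hF : BasePointFree F) {x : X.Pt} {a : L.ι}
    (ha : x ∈ L.U a) : ∃ c : ℂ, c ≠ 0 ∧ ∀ e : F, (kodaira F hF x).rep e = c * e.1.1 a ⟨x, ha⟩ := by
  obtain ⟨c, hc⟩ := Projectivization.exists_smul_eq_mk_rep ℂ (evalForm F x) (evalForm_ne_zero hF x)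
  refine ⟨c * L.g (L.chart x) a ⟨x, L.mem_chart x, ha⟩, mul_ne_zero c.ne_zero (g_ne_zero (L.mem_chart x) ha),
    fun e => ?_⟩
  rw [kodaira, ← hc, mul_assoc, ← e.1.2.2]
  rfl

theorem kodaira_rep_ne_zero {F : Submodule ℂ L.H0} (hF : BasePointFree F) {x : X.Pt} {a : L.ι}
    (ha : x ∈ L.U a) (e : F) : (kodaira F hF x).rep e ≠ 0 ↔ e.1.1 a ⟨x, ha⟩ ≠ 0 := by
  obtain ⟨c, hc, h⟩ := exists_kodaira_rep hF ha
  rw [h, mul_ne_zero_iff]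
  exact and_iff_right hc

theorem kodaira_rep_div {F : Submodule ℂ L.H0} (hF : BasePointFree F) {x : X.Pt} {a : L.ι}
    (ha : x ∈ L.U a) (e e' : F) : (kodaira F hF x).rep e / (kodaira F hF x).rep e' =
      e.1.1 a ⟨x, ha⟩ / e'.1.1 a ⟨x, ha⟩ := by
  obtain ⟨c, hc, h⟩ := exists_kodaira_rep hF ha
  rw [h, h, mul_div_mul_left _ _ hc]

/-- The locus in a chart where a section does not vanish. -/
def basicOpen (s : L.H0) (a : L.ι) : Set X.Pt := {x | ∃ h : x ∈ L.U a, s.1 a ⟨x, h⟩ ≠ 0}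

theorem isOpen_basicOpen (s : L.H0) (a : L.ι) : IsOpen[X.zariski] (basicOpen s a) :=
  (s.2.1 a).isOpen_ne_zero (L.isOpen a)

theorem isRegular_div (s t : L.H0) (a : L.ι) :
    QPVariety.IsRegular fun x : basicOpen t a => s.1 a ⟨x.1, x.2.1⟩ / t.1 a ⟨x.1, x.2.1⟩ := by
  simp only [div_eq_mul_inv]
  have h : basicOpen t a ⊆ L.U a := fun x hx => hx.1
  exact ((s.2.1 a).restrict h).mul (((t.2.1 a).restrict h).inv fun x => x.2.2)

/-- A polynomial relation between ratios of sections can be tested on a non-empty open set. -/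
theorem exists_mem_eval_kodaira_ne_zero {F : Submodule ℂ L.H0} (hF : BasePointFree F)
    {U : Set X.Pt} (hU : IsOpen[X.zariski] U) (hU' : U.Nonempty) {m : Type*} (b : m → F) (e : F)
    (P : MvPolynomial m ℂ) {x : X.Pt} (hx : (kodaira F hF x).rep e ≠ 0)
    (hP : MvPolynomial.eval (fun j => (kodaira F hF x).rep (b j) / (kodaira F hF x).rep e) P ≠ 0) :
    ∃ y ∈ U, (kodaira F hF y).rep e ≠ 0 ∧ MvPolynomial.eval
      (fun j => (kodaira F hF y).rep (b j) / (kodaira F hF y).rep e) P ≠ 0 := by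
  have hx' := (kodaira_rep_ne_zero hF (L.mem_chart x) e).1 hx
  have ho := (QPVariety.IsRegular.eval (fun j => isRegular_div (b j).1 e.1 (L.chart x))
    P).isOpen_ne_zero (isOpen_basicOpen _ _)
  have key : ∀ y (hy : y ∈ basicOpen e.1 (L.chart x)),
      MvPolynomial.eval (fun j => (kodaira F hF y).rep (b j) / (kodaira F hF y).rep e) P =
      MvPolynomial.eval (fun j => (b j).1.1 _ ⟨y, hy.1⟩ / e.1.1 _ ⟨y, hy.1⟩) P := fun y hy => by
    simp only [kodaira_rep_div hF hy.1]
  obtain ⟨y, ⟨hy, hyP⟩, hyU⟩ := QPVariety.nonempty_inter_of_isOpen ho hU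
    ⟨x, ⟨L.mem_chart x, hx'⟩, by rwa [← key x ⟨L.mem_chart x, hx'⟩]⟩ hU'
  exact ⟨y, hyU, (kodaira_rep_ne_zero hF hy.1 e).2 hy.2, by rwa [key y hy]⟩

end SingleBundle

variable {k : ℕ} {L : Fin k → LineBundle.{u, w} X}

/-- Non-vanishing of a polynomial on the systems with a common root can be tested on systems with
a common root in a given non-empty open set. -/
theorem exists_mem_incidence_of_eval_ne_zero {E : ∀ i, Submodule ℂ (L i).H0}
    (hE : ∀ i, BasePointFree (E i)) {U : Set X.Pt} (hU : IsOpen[X.zariski] U) (hU' : U.Nonempty)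
    {m : Type*} (β : Module.Basis m ℂ (∀ i, E i)) (P : MvPolynomial m ℂ) {x : X.Pt} {s : ∀ i, E i}
    (hs : (x, s) ∈ incidence E) (hP : MvPolynomial.eval (fun j => β.repr s j) P ≠ 0) :
    ∃ y ∈ U, ∃ s', (y, s') ∈ incidence E ∧ MvPolynomial.eval (fun j => β.repr s' j) P ≠ 0 := by
  classical
  choose t ht htx using fun i => hE i x
  let a := fun i => (L i).chart x
  let N : Set X.Pt := ⋂ i, basicOpen (t i) (a i)
  have hN : IsOpen[X.zariski] N :=
    @isOpen_iInter_of_finite _ _ X.zariski _ _ fun i => isOpen_basicOpen (t i) (a i)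
  have hNi : ∀ i, N ⊆ basicOpen (t i) (a i) := fun i => Set.iInter_subset _ i
  let f : Fin k → N → ℂ := fun i y =>
    (s i).1.1 (a i) ⟨y.1, (hNi i y.2).1⟩ / (t i).1 (a i) ⟨y.1, (hNi i y.2).1⟩
  have hf : ∀ i, QPVariety.IsRegular (f i) := fun i =>
    (isRegular_div (s i).1 (t i) (a i)).restrict (hNi i)
  -- Correcting `s` by multiples of `t i` makes it vanish at `y`, with no correction at `y = x`.
  -- This is a regular family through `s`, so non-vanishing of `P` spreads to a nonempty open set,
  -- which meets `U`.
  let s' : N → ∀ i, E i := fun y i => s i - f i y • ⟨t i, ht i⟩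
  have hs' : ∀ y : N, (y.1, s' y) ∈ incidence E := fun y i => by
    rw [vanishes_iff _ _ (a i) (hNi i y.2).1]
    change (s i).1.1 (a i) ⟨y.1, _⟩ - f i y * (t i).1 (a i) ⟨y.1, _⟩ = 0
    rw [div_mul_cancel₀ _ (hNi i y.2).2, sub_self]
  let Q : MvPolynomial (Fin k) ℂ := MvPolynomial.bind₁ (fun j => MvPolynomial.C (β.repr s j) -
    ∑ i, MvPolynomial.X i * MvPolynomial.C (β.repr (Pi.single i ⟨t i, ht i⟩) j)) P
  have hQ : ∀ y : N, MvPolynomial.eval (fun i => f i y) Q =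
      MvPolynomial.eval (fun j => β.repr (s' y) j) P := fun y => by
    have : s' y = s - ∑ i, f i y • Pi.single (M := fun i => E i) i ⟨t i, ht i⟩ := by
      ext1 i
      simp only [s', Pi.sub_apply, Finset.sum_apply, Pi.smul_apply]
      rw [Finset.sum_eq_single i]
      · rw [Pi.single_eq_same]
      · intro j _ hj
        rw [Pi.single_eq_of_ne hj.symm, smul_zero]
      · simp
    refine (MvPolynomial.eval₂Hom_bind₁ (RingHom.id ℂ) _ _ P).trans
      (congrArg (fun z => MvPolynomial.eval z P) (funext fun j => ?_))
    change MvPolynomial.eval (fun i => f i y) _ = _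
    simp only [map_sub, map_sum, map_mul, MvPolynomial.eval_C, MvPolynomial.eval_X]
    rw [this]
    refine .trans ?_ (map_sub (β.coord j) _ _).symm
    rw [map_sum]
    refine congrArg _ (Finset.sum_congr rfl fun i _ => ?_)
    rw [map_smul]
    rfl
  have hxN : x ∈ N := Set.mem_iInter.2 fun i =>
    ⟨(L i).mem_chart x, fun h => htx i ((vanishes_iff _ _ _ _).2 h)⟩
  have hsx : s' ⟨x, hxN⟩ = s := by
    ext1 i
    have h1 : f i ⟨x, hxN⟩ = 0 := by
      simp only [f]
      rw [hs i (a i) _, zero_div]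
    change s i - f i ⟨x, hxN⟩ • _ = s i
    rw [h1, zero_smul]
    exact sub_zero (s i)
  obtain ⟨y, ⟨hy, hyP⟩, hyU⟩ := QPVariety.nonempty_inter_of_isOpen
    ((QPVariety.IsRegular.eval hf Q).isOpen_ne_zero hN) hU ⟨x, hxN, by rwa [hQ, hsx]⟩ hU'
  exact ⟨y, hyU, s' ⟨y, hy⟩, hs' ⟨y, hy⟩, by rwa [← hQ]⟩

/-- An affine open subset of `X`, with coordinate ring `B`, on which the bundles are trivialised by
non-vanishing elements of the chosen bases of the linear series. -/
structure AffineModel (E : ∀ i, Submodule ℂ (L i).H0) where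
  U : Set X.Pt
  isOpen : IsOpen[X.zariski] U
  nonempty : U.Nonempty
  n : Fin k → ℕ
  basis : ∀ i, Module.Basis (Fin (n i)) ℂ (E i)
  p : ∀ i, Fin (n i)
  a : ∀ i, (L i).ι
  subset : ∀ i, U ⊆ basicOpen (basis i (p i)).1 (a i)
  B : Subalgebra ℂ (U → ℂ)
  fg : B.FG
  regular : ∀ b ∈ B, QPVariety.IsRegular b
  ratio_mem : ∀ i (s : E i), (fun x : U => s.1.1 (a i) ⟨x.1, (subset i x.2).1⟩ /
    (basis i (p i)).1.1 (a i) ⟨x.1, (subset i x.2).1⟩) ∈ B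
  exists_eval : ∀ ψ : B →ₐ[ℂ] ℂ, ∃ x : U, ∀ b : B, ψ b = b.1 x

variable {E : ∀ i, Submodule ℂ (L i).H0}

theorem exists_basis_fin (M : Type*) [AddCommGroup M] [Module ℂ M] [FiniteDimensional ℂ M] :
    ∃ n, Nonempty (Module.Basis (Fin n) ℂ M) :=
  ⟨_, ⟨Module.finBasis ℂ M⟩⟩

/-- Base-point-freeness makes some basis element of each `E i` nonzero at a fixed point. An affine
neighbourhood is then taken on which the finitely many ratios of basis elements lie in `B`; other
sections follow by linearity. -/
theorem nonempty_affineModel [FiniteDimensional ℂ V] [∀ i, FiniteDimensional ℂ (E i)] (hE : ∀ i, BasePointFree (E i)) :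
    Nonempty (AffineModel E) := by
  obtain ⟨x, hx⟩ := X.irreducible.1
  let x₀ : X.Pt := ⟨x, hx⟩
  let a := fun i => (L i).chart x₀
  choose n b' using fun i => exists_basis_fin (E i)
  let b := fun i => (b' i).some
  have hp : ∀ i, ∃ p, evalForm (E i) x₀ (b i p) ≠ 0 := fun i => by
    by_contra! h
    exact evalForm_ne_zero (hE i) x₀ ((b i).ext h)
  choose p hp using hp
  let N : Set X.Pt := ⋂ i, basicOpen (b i (p i)).1 (a i)
  have hN : IsOpen[X.zariski] N :=
    @isOpen_iInter_of_finite _ _ X.zariski _ _ fun i => isOpen_basicOpen _ (a i)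
  have hNi : ∀ i, N ⊆ basicOpen (b i (p i)).1 (a i) := fun i => Set.iInter_subset _ i
  have hx₀ : x₀ ∈ N := Set.mem_iInter.2 fun i => ⟨(L i).mem_chart x₀, hp i⟩
  obtain ⟨U, hUN, B, hU, hxU, hfg, hreg, hmem, heval⟩ := QPVariety.exists_affine_nhd hN hx₀
    (fun (j : Σ i, Fin (n i)) (y : N) =>
      (b j.1 j.2).1.1 (a j.1) ⟨y.1, (hNi j.1 y.2).1⟩ /
        (b j.1 (p j.1)).1.1 (a j.1) ⟨y.1, (hNi j.1 y.2).1⟩)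
    fun j => (isRegular_div (b j.1 j.2).1 (b j.1 (p j.1)).1 (a j.1)).restrict (hNi j.1)
  refine ⟨⟨U, hU, ⟨x₀, hxU⟩, n, b, p, a, fun i => hUN.trans (hNi i), B, hfg, hreg, fun i s => ?_, heval⟩⟩
  let r : E i →ₗ[ℂ] (U → ℂ) :=
    { toFun := fun s x => s.1.1 (a i) ⟨x.1, (hNi i (hUN x.2)).1⟩ /
        (b i (p i)).1.1 (a i) ⟨x.1, (hNi i (hUN x.2)).1⟩
      map_add' := fun s s' => funext fun x => add_div _ _ _
      map_smul' := fun c s => funext fun x => mul_div_assoc _ _ _ }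
  change r s ∈ B
  rw [← (b i).sum_repr s, map_sum]
  refine B.sum_mem fun j _ => ?_
  rw [map_smul]
  exact B.smul_mem (hmem ⟨i, j⟩) _

/-! ### Ratios of sections in the coordinate ring -/

namespace AffineModel

variable (M : AffineModel E)

/-- The non-vanishing loci of two nonzero regular functions are nonempty open sets, and these meet
by irreducibility. -/
instance : IsDomain M.B := by
  have : Nonempty M.U := M.nonempty.to_subtype
  have : NoZeroDivisors M.B := by
    refine ⟨fun {f g} hfg => ?_⟩
    by_contra! h
    have hne : ∀ f : M.B, f ≠ 0 → {x | ∃ h : x ∈ M.U, f.1 ⟨x, h⟩ ≠ 0}.Nonempty := fun f hf => by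
      by_contra hcon
      refine hf (Subtype.ext (funext fun x => ?_))
      by_contra hx
      exact hcon ⟨x.1, x.2, hx⟩
    obtain ⟨x, ⟨hx, hfx⟩, ⟨_, hgx⟩⟩ := QPVariety.nonempty_inter_of_isOpen
      ((M.regular f.1 f.2).isOpen_ne_zero M.isOpen) ((M.regular g.1 g.2).isOpen_ne_zero M.isOpen)
      (hne f h.1) (hne g h.2)
    exact mul_ne_zero hfx hgx (congrFun (congrArg Subtype.val hfg) ⟨x, hx⟩)
  have : Nontrivial M.B := inferInstance
  exact NoZeroDivisors.to_isDomain _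

/-- The value at a point of the affine open set. -/
def eval (x : M.U) : M.B →ₐ[ℂ] ℂ := (Pi.evalAlgHom ℂ (fun _ : M.U => ℂ) x).comp M.B.val

theorem exists_eq_eval (ψ : M.B →ₐ[ℂ] ℂ) : ∃ x, ψ = M.eval x := by
  obtain ⟨x, hx⟩ := M.exists_eval ψ
  exact ⟨x, AlgHom.ext hx⟩

theorem eq_zero_of_eval {b : M.B} (h : ∀ x, M.eval x b = 0) : b = 0 :=
  Subtype.ext (funext h)

/-- The trivialising sections. -/
def t (i : Fin k) : E i := M.basis i (M.p i)

theorem mem_U (x : M.U) (i : Fin k) : x.1 ∈ (L i).U (M.a i) := (M.subset i x.2).1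

theorem t_ne_zero (x : M.U) (i : Fin k) : (M.t i).1.1 (M.a i) ⟨x.1, M.mem_U x i⟩ ≠ 0 :=
  (M.subset i x.2).2

/-- A section divided by the trivialising section. -/
def ratio (i : Fin k) : E i →ₗ[ℂ] M.B where
  toFun s := ⟨_, M.ratio_mem i s⟩
  map_add' _ _ := Subtype.ext (funext fun _ => add_div _ _ _)
  map_smul' _ _ := Subtype.ext (funext fun _ => mul_div_assoc _ _ _)

theorem eval_ratio (x : M.U) (i : Fin k) (s : E i) : M.eval x (M.ratio i s) =
    s.1.1 (M.a i) ⟨x.1, M.mem_U x i⟩ / (M.t i).1.1 (M.a i) ⟨x.1, M.mem_U x i⟩ := rfl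

theorem ratio_t (i : Fin k) : M.ratio i (M.t i) = 1 :=
  Subtype.ext (funext fun x => div_self (M.t_ne_zero x i))

theorem vanishes_iff_eval_ratio (x : M.U) (i : Fin k) (s : E i) :
    Vanishes s.1 x.1 ↔ M.eval x (M.ratio i s) = 0 := by
  rw [vanishes_iff _ _ _ (M.mem_U x i), eval_ratio, div_eq_zero_iff]
  exact (or_iff_left (M.t_ne_zero x i)).symm

variable (J : Finset (Fin k))

theorem mem_U_tensor (x : M.U) :
    x.1 ∈ (tensor fun j : J => L j).U fun j : J => M.a j := Set.mem_iInter.2 fun j => M.mem_U x j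

theorem ratioProd_mem (e : (tensor fun j : J => L j).H0) (he : e ∈ seriesProd fun j : J => E j) :
    (fun x : M.U => e.1 (fun j : J => M.a j) ⟨x.1, M.mem_U_tensor J x⟩ /
      ∏ j : J, (M.t j).1.1 (M.a j) ⟨x.1, M.mem_U x j⟩) ∈ M.B := by
  induction he using Submodule.span_induction with
  | mem e he =>
    obtain ⟨s, hs, rfl⟩ := he
    convert (∏ j : J, M.ratio j ⟨s j, hs j⟩).2 using 1
    ext x
    change _ = M.eval x (∏ j : J, M.ratio j ⟨s j, hs j⟩)
    rw [map_prod]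
    simp only [eval_ratio]
    rw [Finset.prod_div_distrib]
    rfl
  | zero =>
    convert M.B.zero_mem using 1
    exact funext fun x => zero_div _
  | add e e' _ _ h h' =>
    convert M.B.add_mem h h' using 1
    exact funext fun x => add_div _ _ _
  | smul c e _ h =>
    convert M.B.smul_mem h c using 1
    exact funext fun x => mul_div_assoc _ _ _

/-- A section of the product series divided by the trivialising section. -/
def ratioProd : (seriesProd fun j : J => E j) →ₗ[ℂ] M.B where
  toFun e := ⟨_, M.ratioProd_mem J e.1 e.2⟩
  map_add' _ _ := Subtype.ext (funext fun _ => add_div _ _ _)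
  map_smul' _ _ := Subtype.ext (funext fun _ => mul_div_assoc _ _ _)

theorem eval_ratioProd (x : M.U) (e : seriesProd fun j : J => E j) :
    M.eval x (M.ratioProd J e) = e.1.1 (fun j : J => M.a j) ⟨x.1, M.mem_U_tensor J x⟩ /
      ∏ j : J, (M.t j).1.1 (M.a j) ⟨x.1, M.mem_U x j⟩ := rfl

variable {J}

/-- The product of sections, as an element of the product series. -/
def mulSection (s : ∀ j : J, E j) : seriesProd fun j : J => E j :=
  ⟨tensorSection fun j => (s j).1, Submodule.subset_span ⟨_, fun j => (s j).2, rfl⟩⟩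

theorem ratioProd_mulSection (s : ∀ j : J, E j) :
    M.ratioProd J (mulSection s) = ∏ j : J, M.ratio j (s j) := by
  refine Subtype.ext (funext fun x => ?_)
  change M.eval x (M.ratioProd J (mulSection s)) = M.eval x (∏ j : J, M.ratio j (s j))
  rw [map_prod, eval_ratioProd]
  simp only [eval_ratio]
  rw [Finset.prod_div_distrib]
  rfl

theorem ratioProd_induction {S : Subalgebra ℂ M.B}
    (hS : ∀ i ∈ J, ∀ s : E i, M.ratio i s ∈ S) (e : seriesProd fun j : J => E j) :
    M.ratioProd J e ∈ S := by
  obtain ⟨e, he⟩ := e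
  induction he using Submodule.span_induction with
  | mem e he =>
    obtain ⟨s, hs, rfl⟩ := he
    rw [show (⟨tensorSection s, _⟩ : seriesProd fun j : J => E j) =
      mulSection fun j => ⟨s j, hs j⟩ from rfl, ratioProd_mulSection]
    exact S.prod_mem fun j _ => hS j.1 j.2 _
  | zero => exact (map_zero (M.ratioProd J)).symm ▸ S.zero_mem
  | add e e' he he' h h' => exact (map_add (M.ratioProd J) ⟨e, he⟩ ⟨e', he'⟩).symm ▸ S.add_mem h h'
  | smul c e he h => exact (map_smul (M.ratioProd J) c ⟨e, he⟩).symm ▸ S.smul_mem h c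

/-- The ratios of all elements of the chosen bases. -/
def coords (j : Σ i, Fin (M.n i)) : M.B :=
  M.ratio j.1 (M.basis j.1 j.2)

theorem coords_p (i : Fin k) : M.coords ⟨i, M.p i⟩ = 1 := M.ratio_t i

theorem algRank_range_ratioProd {m : Type*} (β : Module.Basis m ℂ (seriesProd fun j : J => E j)) :
    algRank (Set.range fun j => M.ratioProd J (β j)) = algRank (M.coords '' {j | j.1 ∈ J}) := by
  classical
  refine algRank_congr ?_ ?_
  · rintro _ ⟨j, rfl⟩
    refine M.ratioProd_induction (fun i hi s => ?_) _
    rw [← (M.basis i).sum_repr s, map_sum]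
    refine Subalgebra.sum_mem _ fun j _ => ?_
    rw [map_smul]
    exact Subalgebra.smul_mem _ (subset_algCl _ (Set.mem_image_of_mem M.coords
      (show (⟨i, j⟩ : Σ i, Fin (M.n i)) ∈ {j | j.1 ∈ J} from hi))) _
  · rintro _ ⟨⟨i, j⟩, hi, rfl⟩
    -- Trivialising sections have ratio 1, so using them in all other factors recovers a single
    -- coordinate from a product section.
    let s : ∀ j : J, E j := Function.update (fun j => M.t j) ⟨i, hi⟩ (M.basis i j)
    have h1 : M.ratioProd J (mulSection s) = M.coords ⟨i, j⟩ := by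
      rw [ratioProd_mulSection, Finset.prod_eq_single (⟨i, hi⟩ : J)]
      · simp only [s, Function.update_self]; rfl
      · intro l _ hl
        simp only [s, Function.update_of_ne hl, ratio_t]
      · simp
    rw [← h1, ← β.linearCombination_repr (mulSection s), Finsupp.linearCombination_apply,
      Finsupp.sum, map_sum]
    refine Subalgebra.sum_mem _ fun j _ => ?_
    rw [map_smul]
    exact Subalgebra.smul_mem _ (subset_algCl _ (Set.mem_range_self j)) _

end AffineModel

end LineBundle

/-! ### The dimension of the Kodaira images -/

theorem div_mem_algCl {D : Type*} [Field D] [Algebra ℂ D] {s : Set D} {a b : D}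
    (ha : a ∈ algCl s) (hb : b ∈ algCl s) : a / b ∈ algCl s := by
  have hb' : b⁻¹ ∈ algCl s := mem_algCl.2 (mem_algCl.1 hb).inv
  rw [div_eq_mul_inv]
  exact mul_mem ha hb'

namespace LineBundle

variable {V : Type u} [AddCommGroup V] [Module ℂ V] {X : QPVariety V}

theorem finiteDimensional_seriesProd {κ : Type} [Fintype κ] {L : κ → LineBundle.{u, w} X}
    (E : ∀ j, Submodule ℂ (L j).H0) [∀ j, FiniteDimensional ℂ (E j)] :
    FiniteDimensional ℂ (seriesProd E) := by
  classical
  choose n b' using fun j => exists_basis_fin (E j)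
  let b := fun j => (b' j).some
  let T : (∀ j, Fin (n j)) → (tensor L).H0 := fun f => tensorSection fun j => (b j (f j)).1
  have hle : seriesProd E ≤ Submodule.span ℂ (Set.range T) := by
    refine Submodule.span_le.2 ?_
    rintro _ ⟨s, hs, rfl⟩
    have hsum : ∀ j a (x : (L j).U a), (s j).1 a x =
        ∑ l, (b j).repr ⟨s j, hs j⟩ l * (b j l).1.1 a x := fun j a x => by
      let ev : E j →ₗ[ℂ] ℂ :=
        { toFun := fun s => s.1.1 a x, map_add' := fun _ _ => rfl, map_smul' := fun _ _ => rfl }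
      have h := congrArg ev ((b j).sum_repr ⟨s j, hs j⟩)
      rw [map_sum] at h
      exact h.symm
    have hT : tensorSection s =
        ∑ f : ∀ j, Fin (n j), (∏ j, (b j).repr ⟨s j, hs j⟩ (f j)) • T f := by
      refine Subtype.ext (funext fun a => funext fun x => ?_)
      let ev : (tensor L).H0 →ₗ[ℂ] ℂ :=
        { toFun := fun s => s.1 a x, map_add' := fun _ _ => rfl, map_smul' := fun _ _ => rfl }
      change ∏ j, (s j).1 (a j) _ = ev _
      simp only [map_sum, map_smul, hsum, Finset.prod_univ_sum, Fintype.piFinset_univ,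
        Finset.prod_mul_distrib]
      rfl
    rw [SetLike.mem_coe, hT]
    exact Submodule.sum_mem _ fun f _ => Submodule.smul_mem _ _ (Submodule.subset_span ⟨f, rfl⟩)
  have := FiniteDimensional.span_of_finite ℂ (Set.finite_range T)
  exact Submodule.finiteDimensional_of_le hle

variable {k : ℕ} {L : Fin k → LineBundle.{u, w} X} {E : ∀ i, Submodule ℂ (L i).H0}
  (hE : ∀ i, BasePointFree (E i))

namespace AffineModel

variable (M : AffineModel E) {J : Finset (Fin k)}

theorem prod_t_ne_zero (x : M.U) :
    ∏ j : J, (M.t j).1.1 (M.a j) ⟨x.1, M.mem_U x j⟩ ≠ 0 :=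
  Finset.prod_ne_zero_iff.2 fun j _ => M.t_ne_zero x j

theorem kodaira_rep_ne_zero_iff (x : M.U) (e : seriesProd fun j : J => E j) :
    (kodaira _ (BasePointFree.prod fun j : J => hE j) x.1).rep e ≠ 0 ↔
      M.eval x (M.ratioProd J e) ≠ 0 := by
  rw [kodaira_rep_ne_zero _ (M.mem_U_tensor J x), eval_ratioProd, div_ne_zero_iff]
  exact (and_iff_left (M.prod_t_ne_zero x)).symm

theorem kodaira_rep_div_eq (x : M.U) (e e' : seriesProd fun j : J => E j) :
    (kodaira _ (BasePointFree.prod fun j : J => hE j) x.1).rep e /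
      (kodaira _ (BasePointFree.prod fun j : J => hE j) x.1).rep e' =
      M.eval x (M.ratioProd J e) / M.eval x (M.ratioProd J e') := by
  rw [kodaira_rep_div _ (M.mem_U_tensor J x), eval_ratioProd, eval_ratioProd]
  exact (div_div_div_cancel_right₀ (M.prod_t_ne_zero x) _ _).symm

/-- On `M.U` the relation specialises directly. A failure elsewhere on `X` would be an open
condition and would occur in `M.U` too. -/
theorem eval_kodaira_eq_zero {K : Type*} [Field K] [Algebra ℂ K] [Algebra M.B K]
    [IsScalarTower ℂ M.B K] [IsFractionRing M.B K] {m : Type*}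
    (β : m → seriesProd fun j : J => E j) (e : seriesProd fun j : J => E j) {P : MvPolynomial m ℂ}
    (hP : MvPolynomial.aeval (fun j => algebraMap M.B K (M.ratioProd J (β j)) /
      algebraMap M.B K (M.ratioProd J e)) P = 0) {y : ℙ ℂ _} (hy : y ∈ kodairaImage E hE J)
    (hye : y.rep e ≠ 0) : MvPolynomial.eval (fun j => y.rep (β j) / y.rep e) P = 0 := by
  obtain ⟨x, rfl⟩ := hy
  by_contra hne
  obtain ⟨x', hx', he, hne'⟩ := exists_mem_eval_kodaira_ne_zero _ M.isOpen M.nonempty β e P hye hne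
  refine hne' ?_
  have h := eval_div_eq_zero (M.eval ⟨x', hx'⟩) (fun j => M.ratioProd J (β j))
    ((M.kodaira_rep_ne_zero_iff hE ⟨x', hx'⟩ e).1 he) hP
  simpa only [← M.kodaira_rep_div_eq hE] using h

/-- The image is covered by standard charts; the coordinates in each satisfy all relations of ratios
of the `M.ratioProd J (β j)` in the fraction field, and division does not raise the rank. -/
theorem krullDimOf_kodairaImage_le {m : Type*} [Finite m]
    (β : Module.Basis m ℂ (seriesProd fun j : J => E j)) :
    krullDimOf (projZariski _) (kodairaImage E hE J) ≤ algRank (M.coords '' {j | j.1 ∈ J}) := by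
  let _ := projZariski (Module.Dual ℂ (seriesProd fun j : J => E j))
  let O : m → Set (kodairaImage E hE J) := fun j => {y | y.1.rep (β j) ≠ 0}
  refine topologicalKrullDim_le_of_cover (O := O) (fun j => ?_) (fun y => ?_) fun e => ?_
  · have h := isOpen_polyEval_ne_zero (MvPolynomial.isHomogeneous_X ℂ
      (Module.Dual.eval ℂ (seriesProd fun j : J => E j) (β j)))
    simp only [polyEval, MvPolynomial.eval_X] at h
    exact h.preimage continuous_subtype_val
  · by_contra! h
    exact y.1.rep_nonzero (β.ext fun j => by simpa [O] using h j)
  · let K := FractionRing M.B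
    let g : m → K := fun j => algebraMap M.B K (M.ratioProd J (β j)) /
      algebraMap M.B K (M.ratioProd J (β e))
    let f : O e → ℙ ℂ (Module.Dual ℂ (seriesProd fun j : J => E j)) := fun y => y.1.1
    have hf : Topology.IsInducing f :=
      Topology.IsInducing.subtypeVal.comp Topology.IsInducing.subtypeVal
    have hfe : ∀ y, (f y).rep (β e) ≠ 0 := fun y => y.2
    have h1 := topologicalKrullDim_le_algRank g (isInducing_specPt_proj β hf (β e) hfe)
      fun P hP y => M.eval_kodaira_eq_zero hE β (β e) hP y.1.2 (hfe y)
    refine h1.trans (WithBot.coe_le_coe.2 ?_)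
    rw [← M.algRank_range_ratioProd β, ← algRank_image (IsScalarTower.toAlgHom ℂ M.B K)
      (IsFractionRing.injective M.B K)]
    refine algRank_mono ?_
    have hmem : ∀ j, algebraMap M.B K (M.ratioProd J (β j)) ∈ algCl (IsScalarTower.toAlgHom ℂ M.B K ''
        Set.range fun j => M.ratioProd J (β j)) := fun j => subset_algCl _ ⟨_, ⟨j, rfl⟩, rfl⟩
    rintro _ ⟨j, rfl⟩
    exact div_mem_algCl (hmem j) (hmem e)

/-- In the chart of the product of the `M.t j` the coordinates of points over `M.U` are values of
elements of `B`, and Chevalley's theorem supplies enough points of the image. -/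
theorem le_krullDimOf_kodairaImage {m : Type*} [Finite m]
    (β : Module.Basis m ℂ (seriesProd fun j : J => E j)) :
    algRank (M.coords '' {j | j.1 ∈ J}) ≤ krullDimOf (projZariski _) (kodairaImage E hE J) := by
  let _ := projZariski (Module.Dual ℂ (seriesProd fun j : J => E j))
  let e : seriesProd fun j : J => E j := mulSection fun j => M.t j
  have he : M.ratioProd J e = 1 := by
    rw [ratioProd_mulSection]
    exact Finset.prod_eq_one fun j _ => M.ratio_t j
  let T : Set (kodairaImage E hE J) := {y | y.1.rep e ≠ 0}
  have hT : topologicalKrullDim T ≤ krullDimOf (projZariski _) (kodairaImage E hE J) :=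
    Topology.IsInducing.subtypeVal.topologicalKrullDim_le
  refine le_trans ?_ hT
  have : Algebra.FiniteType ℂ M.B := M.B.fg_iff_finiteType.1 M.fg
  obtain ⟨F, hF, hlift⟩ := exists_lift_of_eval_ne_zero fun j => M.ratioProd J (β j)
  rw [← M.algRank_range_ratioProd β]
  let f : T → ℙ ℂ (Module.Dual ℂ (seriesProd fun j : J => E j)) := fun y => y.1.1
  have hf : Topology.IsInducing f :=
    Topology.IsInducing.subtypeVal.comp Topology.IsInducing.subtypeVal
  have hfe : ∀ y, (f y).rep e ≠ 0 := fun y => y.2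
  refine algRank_le_topologicalKrullDim _ (isInducing_specPt_proj β hf e hfe) (fun P hP y => ?_) hF fun z hz hzF => ?_
  · let K := FractionRing M.B
    refine M.eval_kodaira_eq_zero (K := K) hE β e ?_ y.1.2 (hfe y)
    simp only [he, map_one, div_one]
    have h := DFunLike.congr_fun (MvPolynomial.comp_aeval (fun j => M.ratioProd J (β j))
      (IsScalarTower.toAlgHom ℂ M.B K)) P
    refine h.symm.trans ?_
    rw [AlgHom.comp_apply, hP, map_zero]
  · obtain ⟨ψ, hψ⟩ := hlift z hz hzF
    obtain ⟨x, rfl⟩ := M.exists_eq_eval ψ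
    refine ⟨⟨⟨_, ⟨x.1, rfl⟩⟩, (M.kodaira_rep_ne_zero_iff hE x e).2 ?_⟩, ?_⟩
    · rw [he, map_one]
      exact one_ne_zero
    · ext j
      refine (M.kodaira_rep_div_eq hE x (β j) e).trans ?_
      rw [he, map_one, div_one, hψ]

theorem krullDimOf_kodairaImage [∀ i, FiniteDimensional ℂ (E i)] (J : Finset (Fin k)) :
    krullDimOf (projZariski _) (kodairaImage E hE J) = algRank (M.coords '' {j | j.1 ∈ J}) := by
  have := finiteDimensional_seriesProd fun j : J => E j
  obtain ⟨n, ⟨β⟩⟩ := exists_basis_fin (seriesProd fun j : J => E j)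
  exact le_antisymm (M.krullDimOf_kodairaImage_le hE β) (M.le_krullDimOf_kodairaImage hE β)

end AffineModel

end LineBundle

/-! ### The dimension of the consistency variety -/

theorem krullDimOf_affineZariski_univ {W : Type*} [AddCommGroup W] [Module ℂ W] {ι : Type*}
    [Finite ι] (β : Module.Basis ι ℂ W) :
    krullDimOf (affineZariski W) Set.univ = (ENat.card ι : WithBot ℕ∞) := by
  let _ := affineZariski W
  rw [← algRank_of_indep (MvPolynomial.algebraicIndependent_X ι ℂ)]
  have hi := isInducing_specPt_affine β
    (Topology.IsInducing.subtypeVal (t := (Set.univ : Set W)))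
  have h : ∀ P : MvPolynomial ι ℂ,
      MvPolynomial.aeval (MvPolynomial.X : ι → MvPolynomial ι ℂ) P = 0 → P = 0 :=
    fun P hP => by rwa [MvPolynomial.aeval_X_left_apply] at hP
  refine le_antisymm (topologicalKrullDim_le_algRank _ hi fun P hP t => ?_)
    (algRank_le_topologicalKrullDim _ hi (fun P hP t => ?_) (F := 1) ?_ fun z _ _ => ?_)
  · rw [h P hP, map_zero]
  · rw [h P hP, map_zero]
  · rw [map_one]
    exact one_ne_zero
  · exact ⟨⟨β.equivFun.symm z, trivial⟩, β.equivFun.apply_symm_apply z⟩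

namespace LineBundle

variable {V : Type u} [AddCommGroup V] [Module ℂ V] {X : QPVariety V}
  {k : ℕ} {L : Fin k → LineBundle.{u, w} X} {E : ∀ i, Submodule ℂ (L i).H0}

/-! ### The generic system with a common root -/

namespace AffineModel

variable (M : AffineModel E)

/-- The index set of the coordinates on the space of systems. -/
abbrev Index : Type := Σ i, Fin (M.n i)

/-- The indices of the trivialising sections. -/
def index (i : Fin k) : M.Index := ⟨i, M.p i⟩

/-- The basis of the space of systems. -/
def systemBasis : Module.Basis M.Index ℂ (∀ i, E i) := Pi.basis M.basis

/-- The coordinates of the generic system with a common root. -/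
def generic : M.Index → MvPolynomial M.Index M.B := genericFamily Sigma.fst M.index M.coords

/-- Evaluation at a point of the affine open set and at values of the variables. -/
def evalAt (x : M.U) (u : M.Index → ℂ) : MvPolynomial M.Index M.B →ₐ[ℂ] ℂ :=
  (MvPolynomial.aeval u : MvPolynomial M.Index ℂ →ₐ[ℂ] ℂ).comp (MvPolynomial.mapAlgHom (M.eval x))

theorem evalAt_X (x : M.U) (u : M.Index → ℂ) (a : M.Index) :
    M.evalAt x u (MvPolynomial.X a) = u a := by
  simp [evalAt]

theorem evalAt_C (x : M.U) (u : M.Index → ℂ) (b : M.B) :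
    M.evalAt x u (MvPolynomial.C b) = M.eval x b := by
  simp [evalAt]

theorem exists_evalAt_ne_zero {P : MvPolynomial M.Index M.B} (hP : P ≠ 0) :
    ∃ x u, M.evalAt x u P ≠ 0 := by
  by_contra! h
  refine hP (MvPolynomial.ext _ _ fun d => M.eq_zero_of_eval fun x => ?_)
  have h1 : MvPolynomial.map (M.eval x).toRingHom P = 0 :=
    MvPolynomial.funext fun u => by
      rw [map_zero]
      exact h x u
  have h2 := congrArg (MvPolynomial.coeff d) h1
  rwa [MvPolynomial.coeff_map] at h2

theorem eval_evalAt_generic (x : M.U) (u : M.Index → ℂ) (P : MvPolynomial M.Index ℂ) :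
    MvPolynomial.eval (fun a => M.evalAt x u (M.generic a)) P =
      M.evalAt x u (MvPolynomial.aeval M.generic P) := by
  rw [← MvPolynomial.coe_aeval_eq_eval]
  exact (DFunLike.congr_fun (MvPolynomial.comp_aeval M.generic (M.evalAt x u)) P).symm

/-- The full sum also contains the omitted term, whose coefficient is 1. Thus the combination takes
the value `u (M.index i)` exactly when the `i`-th equation holds at `x`. -/
theorem evalAt_genericComb (x : M.U) (u : M.Index → ℂ) (i : Fin k) :
    M.evalAt x u (genericComb Sigma.fst M.index M.coords i) =
      u (M.index i) - ∑ j, u ⟨i, j⟩ * M.eval x (M.coords ⟨i, j⟩) := by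
  classical
  have h1 : ∑ j, u ⟨i, j⟩ * M.eval x (M.coords ⟨i, j⟩) =
      ∑ a : M.Index with a.1 = i, u a * M.eval x (M.coords a) := by
    rw [Finset.sum_filter, Fintype.sum_sigma, Finset.sum_eq_single i]
    · simp
    · intro j _ hj
      simp [hj]
    · simp
  have h2 : M.evalAt x u (genericComb Sigma.fst M.index M.coords i) =
      -∑ a : M.Index with a.1 = i ∧ a ≠ M.index i, u a * M.eval x (M.coords a) := by
    rw [genericComb, map_neg, map_sum]
    congr 1
    refine Finset.sum_congr (by congr) fun a _ => ?_
    rw [map_mul, evalAt_C, evalAt_X, mul_comm]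
  have h3 : ({a : M.Index | a.1 = i} : Finset M.Index) =
      insert (M.index i) ({a : M.Index | a.1 = i ∧ a ≠ M.index i} : Finset M.Index) := by
    ext a
    simp only [Finset.mem_filter, Finset.mem_univ, true_and, Finset.mem_insert]
    by_cases h : a = M.index i
    · simp [h, index]
    · simp [h]
  rw [h1, h2, h3, Finset.sum_insert (by simp), index, M.coords_p, map_one]
  ring

theorem mem_incidence_iff (x : M.U) (s : ∀ i, E i) : (x.1, s) ∈ incidence E ↔
    ∀ i, ∑ j, M.systemBasis.repr s ⟨i, j⟩ * M.eval x (M.coords ⟨i, j⟩) = 0 := by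
  refine forall_congr' fun i => ?_
  change Vanishes (s i).1 x.1 ↔ _
  rw [M.vanishes_iff_eval_ratio, ← congrArg (M.ratio i) ((M.basis i).sum_repr (s i)), map_sum,
    map_sum]
  refine Eq.congr_left (Finset.sum_congr rfl fun j _ => ?_)
  rw [map_smul, map_smul, smul_eq_mul, systemBasis, Pi.basis_repr]
  rfl

theorem generic_of_ne {a : M.Index} (ha : a ≠ M.index a.1) : M.generic a = MvPolynomial.X a :=
  if_neg ha

theorem generic_index (i : Fin k) :
    M.generic (M.index i) = genericComb Sigma.fst M.index M.coords i :=
  if_pos rfl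

theorem evalAt_generic_of_mem_incidence {x : M.U} {s : ∀ i, E i} (h : (x.1, s) ∈ incidence E)
    (a : M.Index) : M.evalAt x (fun a => M.systemBasis.repr s a) (M.generic a) =
      M.systemBasis.repr s a := by
  by_cases ha : a = M.index a.1
  · rw [ha, generic_index, evalAt_genericComb, (M.mem_incidence_iff x s).1 h, sub_zero]
  · rw [M.generic_of_ne ha, evalAt_X]

theorem mem_incidence_of_evalAt_generic {x : M.U} {s : ∀ i, E i} (u : M.Index → ℂ)
    (h : ∀ a, M.systemBasis.repr s a = M.evalAt x u (M.generic a)) : (x.1, s) ∈ incidence E := by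
  refine (M.mem_incidence_iff x s).2 fun i => ?_
  have h1 : M.evalAt x (fun a => M.systemBasis.repr s a)
      (genericComb Sigma.fst M.index M.coords i) = M.systemBasis.repr s (M.index i) := by
    rw [h, generic_index, genericComb, map_neg, map_neg, map_sum, map_sum]
    refine congrArg _ (Finset.sum_congr rfl fun a ha => ?_)
    have ha' : a ≠ M.index a.1 := by
      obtain ⟨rfl, h2⟩ : a.1 = i ∧ a ≠ M.index i := by simpa using ha
      exact h2
    rw [map_mul, map_mul, evalAt_C, evalAt_C, evalAt_X, evalAt_X, h, M.generic_of_ne ha', evalAt_X]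
  rw [evalAt_genericComb] at h1
  exact sub_eq_self.1 h1

/-- Systems with a root in `M.U` are specialisations of `M.generic`. Non-vanishing at a system with
a root anywhere would propagate to one of these, and the closure adds nothing. -/
theorem eval_eq_zero_of_mem_consistencyVariety (hE : ∀ i, BasePointFree (E i))
    {P : MvPolynomial M.Index ℂ} (hP : MvPolynomial.aeval M.generic P = 0) {s : ∀ i, E i}
    (hs : s ∈ consistencyVariety E) :
    MvPolynomial.eval (fun a => M.systemBasis.repr s a) P = 0 := by
  let _ := affineZariski (∀ i, E i)
  by_contra hne
  obtain ⟨p, hp⟩ := exists_polyEval_eq (M := ∀ i, E i) M.systemBasis P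
  have ho : IsOpen {s : ∀ i, E i | polyEval p s ≠ 0} :=
    TopologicalSpace.isOpen_generateFrom_of_mem ⟨p, rfl⟩
  obtain ⟨s₁, hs₁, ⟨⟨x, _⟩, hx, rfl⟩⟩ := mem_closure_iff.1 hs _ ho (by rwa [Set.mem_ofPred_eq, hp])
  rw [Set.mem_ofPred_eq, hp] at hs₁
  obtain ⟨y, hy, s', hys, hne'⟩ := exists_mem_incidence_of_eval_ne_zero hE M.isOpen M.nonempty
    M.systemBasis P hx hs₁
  refine hne' ?_
  have h := M.eval_evalAt_generic ⟨y, hy⟩ (fun a => M.systemBasis.repr s' a) P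
  rw [hP, map_zero] at h
  simpa only [M.evalAt_generic_of_mem_incidence (x := ⟨y, hy⟩) hys] using h

/-- A polynomial not vanishing at `s` is not a relation of `M.generic`, so some specialisation, a
system with a root in `M.U`, lies in the given neighbourhood of `s`. -/
theorem mem_consistencyVariety {s : ∀ i, E i}
    (h : ∀ P : MvPolynomial M.Index ℂ, MvPolynomial.aeval M.generic P = 0 →
      MvPolynomial.eval (fun a => M.systemBasis.repr s a) P = 0) : s ∈ consistencyVariety E := by
  let _ := affineZariski (∀ i, E i)
  refine mem_closure_iff.2 fun O hO hsO => ?_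
  obtain ⟨p, h1, h2⟩ := exists_polyEval_of_isOpen hO s hsO
  obtain ⟨P, hP⟩ := exists_eval_repr_eq (M := ∀ i, E i) M.systemBasis p
  obtain ⟨x, u, hxu⟩ := M.exists_evalAt_ne_zero fun h0 => h1 (by rw [← hP]; exact h P h0)
  let s' : ∀ i, E i := M.systemBasis.equivFun.symm fun a => M.evalAt x u (M.generic a)
  have hs' : ∀ a, M.systemBasis.repr s' a = M.evalAt x u (M.generic a) := fun a =>
    congrFun (M.systemBasis.equivFun.apply_symm_apply _) a
  refine ⟨s', h2 _ ?_, ⟨(x.1, s'), M.mem_incidence_of_evalAt_generic u hs', rfl⟩⟩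
  rw [← hP]
  simpa only [hs', eval_evalAt_generic] using hxu

theorem krullDimOf_consistencyVariety (hE : ∀ i, BasePointFree (E i)) :
    krullDimOf (affineZariski (∀ i, E i)) (consistencyVariety E) =
      algRank (Set.range M.generic) := by
  let _ := affineZariski (∀ i, E i)
  have hi := isInducing_specPt_affine M.systemBasis
    (Topology.IsInducing.subtypeVal (t := consistencyVariety E))
  have h : ∀ P : MvPolynomial M.Index ℂ, MvPolynomial.aeval M.generic P = 0 →
      ∀ s : consistencyVariety E, MvPolynomial.eval (fun a => M.systemBasis.repr s.1 a) P = 0 :=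
    fun P hP s => M.eval_eq_zero_of_mem_consistencyVariety hE hP s.2
  -- The consistency variety is the whole zero set of the relations, so no open subset has to be
  -- removed and `F = 1` works.
  refine le_antisymm (topologicalKrullDim_le_algRank _ hi h)
    (algRank_le_topologicalKrullDim _ hi h (F := 1) ?_ fun z hz _ => ?_)
  · rw [map_one]
    exact one_ne_zero
  · have hs : ∀ a, M.systemBasis.repr (M.systemBasis.equivFun.symm z) a = z a := fun a =>
      congrFun (M.systemBasis.equivFun.apply_symm_apply z) a
    refine ⟨⟨M.systemBasis.equivFun.symm z, M.mem_consistencyVariety fun P hP => ?_⟩, funext hs⟩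
    rw [funext hs]
    exact hz P hP

end AffineModel

end LineBundle

theorem krullDimOf_eq_dimOf {T : Type*} {t : TopologicalSpace T} {S : Set T} {r : ℕ∞}
    (h : krullDimOf t S = r) (hr : r ≠ ⊤) : krullDimOf t S = dimOf t S ∧ (dimOf t S : ℕ∞) = r := by
  obtain ⟨n, rfl⟩ := ENat.ne_top_iff_exists.1 hr
  have : dimOf t S = n := by
    rw [dimOf, h]
    rfl
  rw [this]
  exact ⟨h, rfl⟩

theorem algRank_ne_top {D : Type*} [CommRing D] [IsDomain D] [Algebra ℂ D] {s : Set D}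
    (hs : s.Finite) : algRank s ≠ ⊤ :=
  ((algRank_le_encard s).trans_lt hs.encard_lt_top).ne

end

theorem mainTheorem1 {V : Type u} [AddCommGroup V] [Module ℂ V] [FiniteDimensional ℂ V]
    (X : QPVariety V) (k : ℕ) (L : Fin k → LineBundle.{u, w} X)
    (E : ∀ i, Submodule ℂ (L i).H0) [∀ i, FiniteDimensional ℂ (E i)]
    (hE : ∀ i, LineBundle.BasePointFree (E i)) :
    -- all the dimensions involved are finite, so that the natural numbers `dimOf` are genuine
    (∀ J : Finset (Fin k),
      krullDimOf (projZariski _) (LineBundle.kodairaImage E hE J) = LineBundle.tau E hE J) ∧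
    krullDimOf (affineZariski (∀ i, E i)) Set.univ =
      dimOf (affineZariski (∀ i, E i)) Set.univ ∧
    krullDimOf (affineZariski (∀ i, E i)) (LineBundle.consistencyVariety E) =
      dimOf (affineZariski (∀ i, E i)) (LineBundle.consistencyVariety E) ∧
    -- the codimension formula
    codimOf (affineZariski (∀ i, E i)) (LineBundle.consistencyVariety E) =
      - LineBundle.minDefect E hE := by
  obtain ⟨M⟩ := LineBundle.nonempty_affineModel hE
  have htau := fun J => krullDimOf_eq_dimOf (M.krullDimOf_kodairaImage hE J)
    (algRank_ne_top ((Set.toFinite {j : M.Index | j.1 ∈ J}).image M.coords))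
  have huniv := krullDimOf_eq_dimOf (krullDimOf_affineZariski_univ (W := ∀ i, E i) M.systemBasis)
    (by rw [ENat.card_eq_coe_fintype_card]; exact ENat.natCast_ne_top _)
  have hR := krullDimOf_eq_dimOf (M.krullDimOf_consistencyVariety hE)
    (algRank_ne_top (Set.finite_range M.generic))
  refine ⟨fun J => (htau J).1, huniv.1, hR.1, ?_⟩
  have hN : dimOf (affineZariski (∀ i, E i)) Set.univ = Fintype.card M.Index := by
    have := huniv.2
    rw [ENat.card_eq_coe_fintype_card] at this
    exact_mod_cast this
  -- In terms of codimension: minus the codimension is at most every defect, and `hge` provides a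
  -- `J` whose defect is at most minus the codimension.
  have hle : ∀ J : Finset (Fin k), dimOf (affineZariski (∀ i, E i)) (LineBundle.consistencyVariety E)
      + J.card ≤ LineBundle.tau E hE J + Fintype.card M.Index := fun J => by
    have h := algRank_genericFamily_le (π := Sigma.fst) (p := M.index) M.coords (fun _ => rfl) J
    rw [← (htau J).2] at h
    have h' := hR.2
    rw [LineBundle.AffineModel.generic] at h'
    rw [← h'] at h
    exact_mod_cast h
  have hge : ∃ J : Finset (Fin k), LineBundle.tau E hE J + Fintype.card M.Index ≤
      dimOf (affineZariski (∀ i, E i)) (LineBundle.consistencyVariety E) + J.card := by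
    obtain ⟨J, h⟩ := exists_le_algRank_genericFamily (π := Sigma.fst) (p := M.index) M.coords
      (fun _ => rfl) M.coords_p
    rw [← (htau J).2] at h
    have h' := hR.2
    rw [LineBundle.AffineModel.generic] at h'
    rw [← h'] at h
    exact ⟨J, by exact_mod_cast h⟩
  rw [codimOf, hN]
  refine neg_eq_iff_eq_neg.1 (le_antisymm ?_ ?_)
  · refine Finset.le_inf' _ _ fun J _ => ?_
    have := hle J
    rw [LineBundle.defect]
    omega
  · obtain ⟨J, hJ⟩ := hge
    refine (Finset.inf'_le _ (Finset.mem_univ J)).trans ?_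
    rw [LineBundle.defect]
    omega
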